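/- **Setting.** Let $\mathcal H$ be a complex Hilbert space, $A$ a self-adjoint operator in $\mathcal H$, bounded from below and with compact resolvent. Let $L\ge 1$, let $\Gamma_1,\dots,\Gamma_L$ be non-zero bounded self-adjoint non-negative operators in $\mathcal H$, let $c_1<c_2<\dots<c_L$ be real, and set $c_0=-\infty$, $c_{L+1}=+\infty$. Define $$S(\lambda)=A-\lambda-\sum_{\ell=1}^L\frac{\Gamma_\ell}{c_\ell-\lambda},\qquad \operatorname{dom}S(\lambda)=\operatorname{dom}A,\qquad \lambda\in\mathbb C\setminus\{c_1,\dots,c_L\},$$ $\sigma(S)=\{\lambda: 0\in\sigma(S(\lambda))\}$, $\sigma_{\rm p}(S)=\{\lambda:\ker S(\lambda)\ne\{0\}\}$, and let $\rho(S)=\{\lambda:0\in\rho(S(\lambda))\}$. The multiplicity of an eigenvalue $\lambda$ of $S$ is $\dim\ker S(\lambda)$. For a self-adjoint operator $T$ with compact resolvent, $\mathcal L_I(T)$ is the spectral subspace of $T$ for $I\subset\mathbb R$, and for $T$ bounded from below $N(T,\mu)=\dim\mathcal L_{(-\infty,\mu]}(T)$. Dimensions take values in $\mathbb N_0\cup\{\infty\}$.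 **Theorem.** For every $u\in\operatorname{dom}A$, $u\neq0$, and $\ell=1,\dots,L+1$, the real function $\lambda\mapsto(S(\lambda)u,u)$ is strictly decreasing on $(c_{\ell-1},c_\ell)$; in particular it has at most one zero there, and either it has a zero there, or it is negative on all of $(c_{\ell-1},c_\ell)$, or it is positive on all of $(c_{\ell-1},c_\ell)$. Define $p_\ell(u)\in[c_{\ell-1},c_\ell]$ to be, respectively, this zero, $c_{\ell-1}$, or $c_\ell$. There are numbers $\kappa_\ell\in\mathbb N_0$, $\ell=1,\dots,L+1$, and $\alpha_{\ell-1}\in(c_{\ell-1},c_\ell)$ with $(c_{\ell-1},\alpha_{\ell-1})\subset\rho(S)$ and $$\dim\mathcal L_{(-\infty,0)}(S(\lambda))=\kappa_\ell\quad\text{for all }\lambda\in(c_{\ell-1},\alpha_{\ell-1}).$$ The spectrum of $S$ satisfies $\sigma(S)=\sigma_{\rm p}(S)$ and consists of $L+1$ finite or infinite sequences $(\lambda_{\ell,j})_{j=1}^{n_\ell}\subset(c_{\ell-1},c_\ell)$, $n_\ell\in\mathbb N_0\cup\{\infty\}$, each of which lists the eigenvalues of $S$ in $(c_{\ell-1},c_\ell)$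 in non-decreasing order and counted with multiplicities, and $$\lambda_{\ell,j}=\min_{\substack{\mathcal L\subset\operatorname{dom}A\\ \dim\mathcal L=j+\kappa_\ell}}\ \max_{\substack{u\in\mathcal L\\ u\ne0}}\ p_\ell(u)\qquad\text{for all } j\in\mathbb N,\ j\le n_\ell,\quad \ell=1,\dots,L+1,$$ where the minimum and all the maxima are attained. The index shifts satisfy $\kappa_1=0$ and $$\kappa_\ell\le N\Big(A-\sum_{j=\ell}^L\frac{\Gamma_j}{c_j-c_{\ell-1}},\,c_{\ell-1}\Big),\quad \ell=2,\dots,L+1,\qquad\text{in particular }\ \kappa_{L+1}\le N(A,c_L).$$ For $k=1,\dots,L$ let $P_k$ and $Q_k$ be the orthogonal projections onto $\mathcal L_{(-\infty,c_k]}(A)$ and onto $\ker\Gamma_k$. If $\ell\in\{2,\dots,L+1\}$ and $\Gamma_{\ell-1}$ has closed range, then for every $\lambda\in(c_{\ell-1},c_\ell)$ $$\kappa_\ell\le \operatorname{rank}\Big(Q_{\ell-1}\Big(P_{\ell-1}(A-\lambda)P_{\ell-1}-\sum_{j=\ell}^L\frac{\Gamma_j}{c_j-\lambda}\Big)Q_{\ell-1}\Big).$$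 Moreover: 1. If $\Gamma_L$ has closed range, then $\kappa_{L+1}\le\operatorname{rank}(P_LQ_L)\le\min\{N(A,c_L),\dim\ker\Gamma_L\}$. 2. $n_{L+1}=\infty$ if and only if $\dim\mathcal H=\infty$; in this case $\lambda_{L+1,j}\to+\infty$ as $j\to\infty$. 3. For $\ell=1,\dots,L$: $n_\ell=\infty$ if and only if $\dim\overline{\operatorname{ran}\Gamma_\ell}=\infty$; in this case $\lambda_{\ell,j}\to c_\ell$ from the left as $j\to\infty$. -/

import Mathlib

noncomputable section

namespace RationalPencil

variable {H : Type*} [NormedAddCommGroup H] [InnerProductSpace ℂ H]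

/-- The dimension of a complex vector space as a number in `ℕ ∪ {∞}`. -/
def dimE (V : Type*) [AddCommGroup V] [Module ℂ V] : ℕ∞ :=
  Cardinal.toENat (Module.rank ℂ V)

/-! ### Unbounded operators -/

/-- `R` is the bounded inverse `(T - z)⁻¹` of the unbounded operator `T - z`. -/
def IsResolventAt (T : H →ₗ.[ℂ] H) (z : ℂ) (R : H →L[ℂ] H) : Prop :=
  (∀ y : H, ∃ h : R y ∈ T.domain, T ⟨R y, h⟩ - z • R y = y) ∧
    ∀ x : T.domain, R (T x - z • (x : H)) = (x : H)

/-- The resolvent set `ρ(T)` of an unbounded operator. -/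
def resolventSet (T : H →ₗ.[ℂ] H) : Set ℂ :=
  {z | ∃ R : H →L[ℂ] H, IsResolventAt T z R}

/-- `T` has compact resolvent. -/
def HasCompactResolvent (T : H →ₗ.[ℂ] H) : Prop :=
  ∃ (z : ℂ) (R : H →L[ℂ] H), IsResolventAt T z R ∧ IsCompactOperator R

/-- The real number `(T u, u)` (real part taken; for symmetric `T` the number is real). -/
def form (T : H →ₗ.[ℂ] H) (u : T.domain) : ℝ :=
  (inner ℂ (u : H) (T u)).re

/-- `T` is bounded from below: `(T u, u) ≥ a ‖u‖²` for some real `a`. -/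
def IsBoundedBelow (T : H →ₗ.[ℂ] H) : Prop :=
  ∃ a : ℝ, ∀ u : T.domain, a * ‖(u : H)‖ ^ 2 ≤ form T u

/-- The eigenspace `ker (T - z)`, as a subspace of `H`. -/
def eigenspace (T : H →ₗ.[ℂ] H) (z : ℂ) : Submodule ℂ H :=
  (LinearMap.ker (T.toFun - z • T.domain.subtype)).map T.domain.subtype

/-- The spectral subspace of `T` for a set `I ⊆ ℝ`: the closed linear span of all eigenvectors
with eigenvalue in `I`. It is only applied to self-adjoint operators with compact resolvent, whose
spectrum is pure point, so that this is the range of the spectral projection for `I`. -/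
def spectralSubspace (T : H →ₗ.[ℂ] H) (I : Set ℝ) : Submodule ℂ H :=
  (⨆ t ∈ I, eigenspace T ((t : ℝ) : ℂ)).topologicalClosure

/-- `N(T, μ)`, the number of eigenvalues of `T` that are `≤ μ`, counted with multiplicities. -/
def eigCount (T : H →ₗ.[ℂ] H) (μ : ℝ) : ℕ∞ :=
  dimE (spectralSubspace T (Set.Iic μ))

/-- The composition `T K` with an everywhere defined operator `K`, on its natural domain
`{x | K x ∈ dom T}`. -/
def precomp (T : H →ₗ.[ℂ] H) (K : H →ₗ[ℂ] H) : H →ₗ.[ℂ] H where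
  domain := T.domain.comap K
  toFun := T.toFun ∘ₗ K.restrict (p := T.domain.comap K) (q := T.domain) (fun _ hx => hx)

/-! ### The rational operator function -/

/-- The poles together with the conventions `c₀ = -∞` and `c_{L+1} = +∞`. -/
def cExt (L : ℕ) (c : ℕ → ℝ) (l : ℕ) : EReal :=
  if l = 0 then ⊥ else if l ≤ L then ((c l : ℝ) : EReal) else ⊤

/-- The open interval `(c_{l-1}, c_l)`, as a set of real numbers. -/
def interval (L : ℕ) (c : ℕ → ℝ) (l : ℕ) : Set ℝ :=
  {t | cExt L c (l - 1) < (t : EReal) ∧ (t : EReal) < cExt L c l}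

/-- The operator `S(z) = A - z - ∑_{l=1}^L Γ_l / (c_l - z)` with domain `dom A`. -/
def schur (A : H →ₗ.[ℂ] H) (L : ℕ) (Γ : ℕ → H →L[ℂ] H) (c : ℕ → ℝ) (z : ℂ) : H →ₗ.[ℂ] H :=
  ((-(z • ContinuousLinearMap.id ℂ H)
    - ∑ l ∈ Finset.Icc 1 L, ((c l : ℂ) - z)⁻¹ • Γ l : H →L[ℂ] H) : H →ₗ[ℂ] H) +ᵥ A

/-- The set `ℂ ∖ {c₁, …, c_L}` on which `S` is defined. -/
def offPoles (L : ℕ) (c : ℕ → ℝ) : Set ℂ :=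
  {z | ∀ l ∈ Finset.Icc 1 L, z ≠ (c l : ℂ)}

/-- The spectrum `σ(S) = {z | 0 ∈ σ(S(z))}` of the operator function. -/
def pencilSpectrum (A : H →ₗ.[ℂ] H) (L : ℕ) (Γ : ℕ → H →L[ℂ] H) (c : ℕ → ℝ) : Set ℂ :=
  {z | z ∈ offPoles L c ∧ (0 : ℂ) ∉ resolventSet (schur A L Γ c z)}

/-- The resolvent set `ρ(S) = {z | 0 ∈ ρ(S(z))}` of the operator function. -/
def pencilResolventSet (A : H →ₗ.[ℂ] H) (L : ℕ) (Γ : ℕ → H →L[ℂ] H) (c : ℕ → ℝ) : Set ℂ :=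
  {z | z ∈ offPoles L c ∧ (0 : ℂ) ∈ resolventSet (schur A L Γ c z)}

/-- The point spectrum `σ_p(S) = {z | ker S(z) ≠ 0}` of the operator function. -/
def pencilPointSpectrum (A : H →ₗ.[ℂ] H) (L : ℕ) (Γ : ℕ → H →L[ℂ] H) (c : ℕ → ℝ) : Set ℂ :=
  {z | z ∈ offPoles L c ∧ eigenspace (schur A L Γ c z) 0 ≠ ⊥}

/-- The function `t ↦ (S(t) u, u)` of a real variable. -/
def schurForm (A : H →ₗ.[ℂ] H) (L : ℕ) (Γ : ℕ → H →L[ℂ] H) (c : ℕ → ℝ) (u : A.domain)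
    (t : ℝ) : ℝ :=
  form (schur A L Γ c (t : ℂ)) u

open Classical in
/-- The generalized Rayleigh functional `p_l(u)`: a zero of `t ↦ (S(t) u, u)` in `(c_{l-1}, c_l)`
if there is one, `c_{l-1}` if this function is negative on the interval, and `c_l` otherwise. -/
def rayleigh (A : H →ₗ.[ℂ] H) (L : ℕ) (Γ : ℕ → H →L[ℂ] H) (c : ℕ → ℝ) (l : ℕ)
    (u : A.domain) : EReal :=
  if h : ∃ t : ℝ, t ∈ interval L c l ∧ schurForm A L Γ c u t = 0 then ((h.choose : ℝ) : EReal)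
  else if ∀ t ∈ interval L c l, schurForm A L Γ c u t < 0 then cExt L c (l - 1)
  else cExt L c l

/-- `m` is the maximum of `p_l(u)` over the non-zero `u` in the subspace `V` of `dom A`. -/
def IsRayleighMax (A : H →ₗ.[ℂ] H) (L : ℕ) (Γ : ℕ → H →L[ℂ] H) (c : ℕ → ℝ) (l : ℕ)
    (V : Submodule ℂ A.domain) (m : EReal) : Prop :=
  IsGreatest {q : EReal | ∃ u ∈ V, u ≠ 0 ∧ q = rayleigh A L Γ c l u} m

/-- The finite or infinite sequence `lam 1, lam 2, …, lam n` enumerates the eigenvalues of `S` in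
`(c_{l-1}, c_l)` in non-decreasing order, each repeated according to its multiplicity
`dim ker S(t)`. -/
def EnumeratesEigenvalues (A : H →ₗ.[ℂ] H) (L : ℕ) (Γ : ℕ → H →L[ℂ] H) (c : ℕ → ℝ) (l : ℕ)
    (n : ℕ∞) (lam : ℕ → ℝ) : Prop :=
  (∀ j : ℕ, 1 ≤ j → (j : ℕ∞) ≤ n → lam j ∈ interval L c l) ∧
  (∀ i j : ℕ, 1 ≤ i → i ≤ j → (j : ℕ∞) ≤ n → lam i ≤ lam j) ∧
  ∀ t ∈ interval L c l,
    Set.encard {j : ℕ | 1 ≤ j ∧ (j : ℕ∞) ≤ n ∧ lam j = t}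
      = dimE (eigenspace (schur A L Γ c (t : ℂ)) 0)

/-! ### Auxiliary operators for the bounds on the index shifts -/

/-- The operator `A - ∑_{j=l}^L Γ_j / (c_j - c_{l-1})`, for `2 ≤ l`. -/
def shiftOp (A : H →ₗ.[ℂ] H) (L : ℕ) (Γ : ℕ → H →L[ℂ] H) (c : ℕ → ℝ) (l : ℕ) : H →ₗ.[ℂ] H :=
  ((-∑ j ∈ Finset.Icc l L, ((c j : ℂ) - (c (l - 1) : ℂ))⁻¹ • Γ j : H →L[ℂ] H) : H →ₗ[ℂ] H) +ᵥ A

variable [CompleteSpace H]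

instance instCompleteSpectralSubspace (T : H →ₗ.[ℂ] H) (I : Set ℝ) :
    CompleteSpace (spectralSubspace T I) :=
  Submodule.topologicalClosure.completeSpace _

/-- The orthogonal projection `P_k` onto the spectral subspace of `A` for `(-∞, c_k]`. -/
def projP (A : H →ₗ.[ℂ] H) (c : ℕ → ℝ) (k : ℕ) : H →L[ℂ] H :=
  (spectralSubspace A (Set.Iic (c k))).starProjection

/-- The orthogonal projection `Q_k` onto `ker Γ_k`. -/
def projQ (Γ : ℕ → H →L[ℂ] H) (k : ℕ) : H →L[ℂ] H :=
  (LinearMap.ker (Γ k : H →ₗ[ℂ] H)).starProjection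

/-- The operator `Q (P (A - t) P - ∑_{j=l}^L Γ_j / (c_j - t)) Q` with `P = P_{l-1}` and
`Q = Q_{l-1}`, for `2 ≤ l`. -/
def compressedOp (A : H →ₗ.[ℂ] H) (L : ℕ) (Γ : ℕ → H →L[ℂ] H) (c : ℕ → ℝ) (l : ℕ) (t : ℝ) :
    H →ₗ.[ℂ] H :=
  let P : H →ₗ[ℂ] H := (projP A c (l - 1) : H →L[ℂ] H)
  let Q : H →ₗ[ℂ] H := (projQ Γ (l - 1) : H →L[ℂ] H)
  let G : H →ₗ[ℂ] H := (∑ j ∈ Finset.Icc l L, ((c j : ℂ) - (t : ℂ))⁻¹ • Γ j : H →L[ℂ] H)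
  let Az : H →ₗ.[ℂ] H := (-((t : ℂ) • (LinearMap.id : H →ₗ[ℂ] H))) +ᵥ A
  Q.compPMap (precomp ((-G) +ᵥ P.compPMap (precomp Az P)) Q)

end RationalPencil

end

noncomputable section

namespace RationalPencil

variable {H : Type*} [NormedAddCommGroup H] [InnerProductSpace ℂ H]

/-! ### Symmetric operators with compact resolvent -/

/-! Fix an interval between consecutive poles. There `t ↦ (S(t)u, u)` decreases at rate at least
`‖u‖²`, because every `-1/(c_j - t)` is decreasing and `Γ_j ≥ 0`. Let `N(t)` and `M(t)` be the
numbers of negative and of non-positive eigenvalues of `S(t)`, so that `M(t) - N(t) = dim ker S(t)`.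
Both are the largest dimensions of subspaces of `dom A` on which the form is negative, respectively
non-positive. Strict decrease gives `M(s) ≤ N(t)` for `s < t`. Compactness on finite-dimensional
subspaces makes `N` left-continuous, and the spectral gap above zero makes `M` right-continuous. The
eigenvalues of `S` are therefore the jumps of an integer-valued monotone function
(`exists_jump_enumeration`). The index shift `κ` is the least value of `N`, and `λ_j` is the least
`t` with `j + κ ≤ M(t)`.

Since `p(u) ≤ t` exactly when `(S(t)u, u) ≤ 0`, the variational description of `M` and `N` becomes
the min-max formula (`min_max_principle`). The spectrum is pure point because `S(z)` is a bounded
perturbation of an operator with compact resolvent. It is real because `Im (S(z)u, u)` is a negative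
multiple of `Im z`.

The bounds on `κ` come from points slightly to the right of `c_{l-1}`. The terms with poles to the
left are non-negative and can be dropped, which leads to the operator `shiftOp`. If `Γ_{l-1}` has
closed range, its term is moreover coercive off `ker Γ_{l-1}` with a constant that tends to
infinity, so negative vectors are controlled by their component in the kernel
(`indexShift_le_dimE_range`). The counts are infinite or finite according to whether `N` is
unbounded near the right end of the interval, where `-t` or `-Γ_l/(c_l - t)` dominates on any fixed
finite-dimensional subspace where it is definite.

The spectral theory needed for `S(t)` rests on one fact: a non-zero compact non-negative operator
has its norm as an eigenvalue. Applied to the resolvent on the complement of a set of eigenvectors,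
it gives `exists_form_lower_bound`. -/

theorem mem_eigenspace {T : H →ₗ.[ℂ] H} {z : ℂ} {u : H} :
    u ∈ eigenspace T z ↔ ∃ h : u ∈ T.domain, T ⟨u, h⟩ = z • u := by
  simp only [eigenspace, Submodule.mem_map, LinearMap.mem_ker]
  constructor
  · rintro ⟨⟨x, hx⟩, h, rfl⟩
    exact ⟨hx, sub_eq_zero.1 h⟩
  · rintro ⟨h, hu⟩
    exact ⟨⟨u, h⟩, sub_eq_zero.2 hu, rfl⟩

/-- The operators to which the spectral theory below applies: symmetric, bounded from below,
with compact resolvent. -/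
structure IsSemiboundedDiscrete (T : H →ₗ.[ℂ] H) : Prop where
  symm : ∀ x y : T.domain, inner ℂ (T x) (y : H) = inner ℂ (x : H) (T y)
  below : IsBoundedBelow T
  compact : HasCompactResolvent T

/-- A bounded perturbation of an operator with compact resolvent has a compact resolvent at every
point that is not an eigenvalue. -/
theorem exists_isResolventAt_vadd [CompleteSpace H] {T : H →ₗ.[ℂ] H}
    (hT : HasCompactResolvent T) (B : H →L[ℂ] H) {w : ℂ}
    (hw : eigenspace ((B : H →ₗ[ℂ] H) +ᵥ T) w = ⊥) :
    ∃ R : H →L[ℂ] H, IsResolventAt ((B : H →ₗ[ℂ] H) +ᵥ T) w R ∧ IsCompactOperator R := by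
  obtain ⟨z, R, hR, hRc⟩ := hT
  have hinj : ∀ x : T.domain, B x + T x = w • (x : H) → (x : H) = 0 := by
    intro x hx
    have : (x : H) ∈ eigenspace ((B : H →ₗ[ℂ] H) +ᵥ T) w :=
      mem_eigenspace.2 ⟨x.2, hx⟩
    rwa [hw, Submodule.mem_bot] at this
  -- With this `K` one has `(B + T - w) R = 1 + K`. Since `K` is compact, the Fredholm alternative
  -- at `-1` reduces invertibility of `1 + K` to injectivity.
  set K : H →L[ℂ] H := (B + (z - w) • ContinuousLinearMap.id ℂ H) ∘L R with hK
  have hKc : IsCompactOperator K :=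
    hRc.clm_comp (B + (z - w) • ContinuousLinearMap.id ℂ H)
  have key : ∀ y : H, ∃ h : R y ∈ T.domain, B (R y) + T ⟨R y, h⟩ - w • R y = y + K y := by
    intro y
    obtain ⟨h, hy⟩ := hR.1 y
    refine ⟨h, ?_⟩
    have hKy : K y = B (R y) + (z - w) • R y := by simp [hK]
    rw [hKy]
    nth_rewrite 4 [← hy]
    module
  have hres : (-1 : ℂ) ∈ _root_.resolventSet ℂ K := by
    refine (hKc.hasEigenvalue_or_mem_resolventSet (by norm_num)).resolve_left fun hev => ?_
    obtain ⟨y, hy⟩ := hev.exists_hasEigenvector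
    have hKy : K y = -y := by simpa using hy.apply_eq_smul
    obtain ⟨h, h1⟩ := key y
    rw [hKy, add_neg_cancel, sub_eq_zero] at h1
    have h0 := hinj ⟨R y, h⟩ h1
    obtain ⟨h', h2⟩ := hR.1 y
    have : (⟨R y, h'⟩ : T.domain) = 0 := Subtype.ext h0
    rw [this] at h2
    simp only [LinearPMap.map_zero] at h2
    simp only at h0
    rw [h0] at h2
    exact hy.2 (by simpa using h2.symm)
  -- Here `U = -1 - K`, so `-U⁻¹` is `(1 + K)⁻¹` and the resolvent sought is `R (1 + K)⁻¹`.
  obtain ⟨U, hU⟩ := hres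
  have hU1 : ∀ y, y = -((U⁻¹ : (H →L[ℂ] H)ˣ) : H →L[ℂ] H) y + K (-((U⁻¹ : (H →L[ℂ] H)ˣ) : H →L[ℂ] H) y) := by
    intro y
    have h1 : (U : H →L[ℂ] H) (((U⁻¹ : (H →L[ℂ] H)ˣ) : H →L[ℂ] H) y) = y := by
      change ((U : H →L[ℂ] H) * ((U⁻¹ : (H →L[ℂ] H)ˣ) : H →L[ℂ] H)) y = y
      rw [U.mul_inv]; rfl
    rw [hU] at h1
    nth_rewrite 1 [← h1]
    simp [Algebra.algebraMap_eq_smul_one, sub_eq_add_neg]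
  refine ⟨R ∘L (-((U⁻¹ : (H →L[ℂ] H)ˣ) : H →L[ℂ] H)), ⟨?_, ?_⟩, ?_⟩
  · intro y
    obtain ⟨h, h1⟩ := key (-((U⁻¹ : (H →L[ℂ] H)ˣ) : H →L[ℂ] H) y)
    exact ⟨h, h1.trans (hU1 y).symm⟩
  · intro x
    set v := (((B : H →ₗ[ℂ] H) +ᵥ T : H →ₗ.[ℂ] H) x - w • (x : H)) with hv
    obtain ⟨h, h1⟩ := key (-((U⁻¹ : (H →L[ℂ] H)ˣ) : H →L[ℂ] H) v)
    have hx : v = B (x : H) + T x - w • (x : H) := rfl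
    replace h1 := (h1.trans (hU1 v).symm).trans hx
    have := hinj (⟨_, h⟩ - x) (by
      rw [T.map_sub]
      simp only [Submodule.coe_sub, map_sub, smul_sub]
      linear_combination (norm := module) h1)
    exact sub_eq_zero.1 this
  · exact hRc.comp_clm _

theorem form_vadd (T : H →ₗ.[ℂ] H) (B : H →L[ℂ] H) (u : T.domain) :
    form ((B : H →ₗ[ℂ] H) +ᵥ T) u = (inner ℂ (u : H) (B u)).re + form T u := by
  have : ((B : H →ₗ[ℂ] H) +ᵥ T : H →ₗ.[ℂ] H) u = B u + T u := rfl
  rw [form, this, inner_add_right, Complex.add_re, form]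

theorem re_inner_bounds (B : H →L[ℂ] H) (u : H) :
    |(inner ℂ u (B u)).re| ≤ ‖B‖ * ‖u‖ ^ 2 := by
  calc |(inner ℂ u (B u)).re| ≤ ‖inner ℂ u (B u)‖ := Complex.abs_re_le_norm _
    _ ≤ ‖u‖ * ‖B u‖ := norm_inner_le_norm _ _
    _ ≤ ‖u‖ * (‖B‖ * ‖u‖) := by gcongr; exact B.le_opNorm u
    _ = _ := by ring

theorem form_of_eigen {T : H →ₗ.[ℂ] H} {u : T.domain} {t : ℝ} (h : T u = (t : ℂ) • (u : H)) :
    form T u = t * ‖(u : H)‖ ^ 2 := by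
  rw [form, h, inner_smul_right, inner_self_eq_norm_sq_to_K, Complex.re_ofReal_mul]
  norm_cast

/-- A bounded symmetric perturbation preserves `IsSemiboundedDiscrete`. -/
theorem isSemiboundedDiscrete_vadd [CompleteSpace H] {T : H →ₗ.[ℂ] H}
    (hT : IsSemiboundedDiscrete T) (B : H →L[ℂ] H)
    (hB : ∀ x y, inner ℂ (B x) y = inner ℂ x (B y)) :
    IsSemiboundedDiscrete ((B : H →ₗ[ℂ] H) +ᵥ T) := by
  obtain ⟨a, ha⟩ := hT.below
  have hbd : ∀ u : T.domain,
      (a - ‖B‖) * ‖(u : H)‖ ^ 2 ≤ form ((B : H →ₗ[ℂ] H) +ᵥ T) u := by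
    intro u
    rw [form_vadd]
    have := (abs_le.1 (re_inner_bounds B u)).1
    have := ha u
    linarith
  refine ⟨fun x y => ?_, ⟨_, hbd⟩, ?_⟩
  · change inner ℂ (B x + T x) _ = inner ℂ _ (B y + T y)
    rw [inner_add_left, inner_add_right, hB, hT.symm]
  · obtain ⟨R, h1, h2⟩ := exists_isResolventAt_vadd hT.compact B
      (w := ((a - ‖B‖ - 1 : ℝ) : ℂ)) (by
        rw [Submodule.eq_bot_iff]
        intro u hu
        obtain ⟨h, hu⟩ := mem_eigenspace.1 hu
        have h1 := form_of_eigen hu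
        have h2 := hbd ⟨u, h⟩
        rw [h1] at h2
        simp only at h2
        have : ‖u‖ ^ 2 ≤ 0 := by linarith
        simpa using this)
    exact ⟨_, R, h1, h2⟩

/-- There are compact resolvents at real points arbitrarily far to the left. -/
theorem IsSemiboundedDiscrete.exists_real_resolvent [CompleteSpace H] {T : H →ₗ.[ℂ] H}
    (hT : IsSemiboundedDiscrete T) (M : ℝ) :
    ∃ (m : ℝ) (R : H →L[ℂ] H), m < M ∧ IsResolventAt T (m : ℂ) R ∧ IsCompactOperator R ∧
      ∀ u : T.domain, (m + 1) * ‖(u : H)‖ ^ 2 ≤ form T u := by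
  obtain ⟨a, ha⟩ := hT.below
  -- Lying one below the lower bound `a` keeps `m` off the eigenvalues and gives the margin `m + 1`
  -- in the form bound.
  set m := min (a - 1) (M - 1) with hm
  have hm1 : m ≤ a - 1 := min_le_left _ _
  have hm2 : m ≤ M - 1 := min_le_right _ _
  have hbd : ∀ u : T.domain, (m + 1) * ‖(u : H)‖ ^ 2 ≤ form T u := fun u =>
    (mul_le_mul_of_nonneg_right (by linarith) (by positivity)).trans (ha u)
  obtain ⟨R, h1, h2⟩ := exists_isResolventAt_vadd hT.compact (0 : H →L[ℂ] H) (w := (m : ℂ)) (by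
    rw [ContinuousLinearMap.toLinearMap_zero, zero_vadd, Submodule.eq_bot_iff]
    intro u hu
    obtain ⟨h, hu⟩ := mem_eigenspace.1 hu
    have h1 := form_of_eigen hu
    have h2 := hbd ⟨u, h⟩
    rw [h1] at h2
    simp only at h2
    have : ‖u‖ ^ 2 ≤ 0 := by linarith
    simpa using this)
  rw [ContinuousLinearMap.toLinearMap_zero, zero_vadd] at h1
  exact ⟨m, R, by linarith, h1, h2, hbd⟩

/-- `‖P x‖² ≤ ‖P‖ (P x, x)` for a non-negative bounded operator `P`. -/
theorem norm_apply_sq_le (P : H →L[ℂ] H) (hs : ∀ x y, inner ℂ (P x) y = inner ℂ x (P y))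
    (hp : ∀ x, 0 ≤ (inner ℂ x (P x)).re) (x : H) :
    ‖P x‖ ^ 2 ≤ ‖P‖ * (inner ℂ x (P x)).re := by
  rcases (norm_nonneg P).eq_or_lt with h0 | h0
  · have : P = 0 := by simpa using h0.symm
    simp [this]
  -- Expanding positivity at this vector gives `(Px, x) - 2‖P‖⁻¹‖Px‖² + ‖P‖⁻²(P²x, Px) ≥ 0`. The
  -- last term is at most `‖P‖⁻¹‖Px‖²`.
  have h1 := hp (x - ((‖P‖⁻¹ : ℝ) : ℂ) • P x)
  have h2 : (inner ℂ (P x) (P (P x))).re ≤ ‖P‖ * ‖P x‖ ^ 2 :=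
    (abs_le.1 (re_inner_bounds P (P x))).2
  have e1 : (inner ℂ x (P (P x)) : ℂ) = ((‖P x‖ ^ 2 : ℝ) : ℂ) := by
    rw [← hs, inner_self_eq_norm_sq_to_K]; norm_cast
  have e2 : (inner ℂ (P x) (P x) : ℂ) = ((‖P x‖ ^ 2 : ℝ) : ℂ) := by
    rw [inner_self_eq_norm_sq_to_K]; norm_cast
  simp only [map_sub, map_smul, inner_sub_left, inner_sub_right, inner_smul_left,
    inner_smul_right, e1, e2, Complex.conj_ofReal, Complex.sub_re, Complex.re_ofReal_mul,
    Complex.ofReal_re] at h1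
  have h3 : ‖P‖⁻¹ * (‖P‖⁻¹ * (inner ℂ (P x) (P (P x))).re) ≤ ‖P‖⁻¹ * ‖P x‖ ^ 2 := by
    have : ‖P‖⁻¹ * (inner ℂ (P x) (P (P x))).re ≤ ‖P x‖ ^ 2 := by
      rw [inv_mul_le_iff₀ h0]; exact h2
    gcongr
  have h4 : ‖P‖⁻¹ * ‖P x‖ ^ 2 ≤ (inner ℂ x (P x)).re := by linarith
  rwa [inv_mul_le_iff₀ h0] at h4

end RationalPencil

/-! ### Spans of eigenvectors and form bounds on their orthogonal complements -/

namespace RationalPencil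

variable {H : Type*} [NormedAddCommGroup H] [InnerProductSpace ℂ H]

/-- The linear span of the eigenspaces for eigenvalues in `I`, before taking the closure. -/
def eigenSpan (T : H →ₗ.[ℂ] H) (I : Set ℝ) : Submodule ℂ H :=
  ⨆ t ∈ I, eigenspace T ((t : ℝ) : ℂ)

theorem eigenspace_le_eigenSpan (T : H →ₗ.[ℂ] H) {I : Set ℝ} {t : ℝ} (ht : t ∈ I) :
    eigenspace T (t : ℂ) ≤ eigenSpan T I :=
  le_iSup₂_of_le t ht le_rfl

theorem eigenspace_le_domain (T : H →ₗ.[ℂ] H) (z : ℂ) : eigenspace T z ≤ T.domain :=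
  fun _ hu => (mem_eigenspace.1 hu).1

theorem eigenSpan_le_domain (T : H →ₗ.[ℂ] H) (I : Set ℝ) : eigenSpan T I ≤ T.domain :=
  iSup₂_le fun t _ => eigenspace_le_domain T t

theorem eigenSpan_mono (T : H →ₗ.[ℂ] H) {I J : Set ℝ} (h : I ⊆ J) :
    eigenSpan T I ≤ eigenSpan T J :=
  iSup₂_le fun _ ht => eigenspace_le_eigenSpan T (h ht)

theorem eigenspace_inner_eq_zero {T : H →ₗ.[ℂ] H}
    (hs : ∀ x y : T.domain, inner ℂ (T x) (y : H) = inner ℂ (x : H) (T y))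
    {s t : ℝ} (hst : s ≠ t) {u v : H} (hu : u ∈ eigenspace T (s : ℂ))
    (hv : v ∈ eigenspace T (t : ℂ)) : inner ℂ u v = 0 := by
  obtain ⟨h1, hu⟩ := mem_eigenspace.1 hu
  obtain ⟨h2, hv⟩ := mem_eigenspace.1 hv
  have := hs ⟨u, h1⟩ ⟨v, h2⟩
  rw [hu, hv, inner_smul_left, inner_smul_right, Complex.conj_ofReal] at this
  have h3 : ((s : ℂ) - t) * inner ℂ u v = 0 := by linear_combination this
  exact (mul_eq_zero.1 h3).resolve_left (sub_ne_zero.2 (by exact_mod_cast hst))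

/-- Vectors in the span of eigenspaces are finite sums of eigenvectors; norms and forms are
computed from the parts. -/
theorem exists_eigen_decomposition {T : H →ₗ.[ℂ] H}
    (hs : ∀ x y : T.domain, inner ℂ (T x) (y : H) = inner ℂ (x : H) (T y))
    {I : Set ℝ} {u : T.domain} (hu : (u : H) ∈ eigenSpan T I) :
    ∃ (s : Finset I) (f : I → H), (u : H) = ∑ t ∈ s, f t ∧
      ‖(u : H)‖ ^ 2 = ∑ t ∈ s, ‖f t‖ ^ 2 ∧
      form T u = ∑ t ∈ s, (t : ℝ) * ‖f t‖ ^ 2 ∧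
      ∀ m : ℝ, ‖T u - (m : ℂ) • (u : H)‖ ^ 2 = ∑ t ∈ s, ((t : ℝ) - m) ^ 2 * ‖f t‖ ^ 2 := by
  rw [eigenSpan, iSup_subtype', Submodule.mem_iSup_iff_exists_finsupp] at hu
  obtain ⟨f, hf, hfu⟩ := hu
  have hV : OrthogonalFamily ℂ (fun t : I => eigenspace T ((t : ℝ) : ℂ))
      (fun t => (eigenspace T ((t : ℝ) : ℂ)).subtypeₗᵢ) := by
    intro s t hst v w
    exact eigenspace_inner_eq_zero hs (fun h => hst (Subtype.ext h)) v.2 w.2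
  have hdom : ∀ t, f t ∈ T.domain := fun t => (mem_eigenspace.1 (hf t)).1
  have hTf : ∀ t, T ⟨f t, hdom t⟩ = ((t : ℝ) : ℂ) • f t := fun t => (mem_eigenspace.1 (hf t)).2
  have hu : (u : H) = ∑ t ∈ f.support, f t := hfu.symm
  have hTu : T u = ∑ t ∈ f.support, ((t : ℝ) : ℂ) • f t := by
    have : u = ∑ t ∈ f.support, (⟨f t, hdom t⟩ : T.domain) := by
      apply Subtype.ext; simp [hu]
    rw [this]
    change T.toFun _ = _
    rw [map_sum]
    exact Finset.sum_congr rfl fun t _ => hTf t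
  refine ⟨f.support, f, hu, ?_, ?_, fun m => ?_⟩
  · rw [hu]
    exact hV.norm_sum (fun t => (⟨f t, hf t⟩ : eigenspace T ((t : ℝ) : ℂ))) f.support
  · have : inner ℂ (∑ t ∈ f.support, f t) (∑ t ∈ f.support, ((t : ℝ) : ℂ) • f t) =
        ∑ t ∈ f.support, inner ℂ (f t) (((t : ℝ) : ℂ) • f t) :=
      hV.inner_sum (fun t => (⟨f t, hf t⟩ : eigenspace T ((t : ℝ) : ℂ)))
        (fun t => ((t : ℝ) : ℂ) • (⟨f t, hf t⟩ : eigenspace T ((t : ℝ) : ℂ))) f.support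
    rw [form, hTu, hu, this, Complex.re_sum]
    refine Finset.sum_congr rfl fun t _ => ?_
    rw [inner_smul_right, inner_self_eq_norm_sq_to_K, Complex.re_ofReal_mul]
    norm_cast
  · have : ‖∑ t ∈ f.support, (((t : ℝ) : ℂ) - (m : ℂ)) • f t‖ ^ 2 =
        ∑ t ∈ f.support, ‖(((t : ℝ) : ℂ) - (m : ℂ)) • f t‖ ^ 2 :=
      hV.norm_sum (fun t => (((t : ℝ) : ℂ) - (m : ℂ)) •
        (⟨f t, hf t⟩ : eigenspace T ((t : ℝ) : ℂ))) f.support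
    rw [hTu, hu, Finset.smul_sum, ← Finset.sum_sub_distrib]
    simp only [← sub_smul]
    rw [this]
    refine Finset.sum_congr rfl fun t _ => ?_
    rw [norm_smul, mul_pow, ← Complex.ofReal_sub, Complex.norm_real, Real.norm_eq_abs, sq_abs]

theorem form_le_of_mem_eigenSpan {T : H →ₗ.[ℂ] H}
    (hs : ∀ x y : T.domain, inner ℂ (T x) (y : H) = inner ℂ (x : H) (T y))
    {μ : ℝ} {u : T.domain} (hu : (u : H) ∈ eigenSpan T (Set.Iic μ)) :
    form T u ≤ μ * ‖(u : H)‖ ^ 2 := by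
  obtain ⟨s, f, -, h1, h2, -⟩ := exists_eigen_decomposition hs hu
  rw [h2, h1, Finset.mul_sum]
  exact Finset.sum_le_sum fun t _ => mul_le_mul_of_nonneg_right t.2 (by positivity)

theorem form_lt_of_mem_eigenSpan {T : H →ₗ.[ℂ] H}
    (hs : ∀ x y : T.domain, inner ℂ (T x) (y : H) = inner ℂ (x : H) (T y))
    {μ : ℝ} {u : T.domain} (hu : (u : H) ∈ eigenSpan T (Set.Iio μ)) (h0 : u ≠ 0) :
    form T u < μ * ‖(u : H)‖ ^ 2 := by
  obtain ⟨s, f, h0', h1, h2, -⟩ := exists_eigen_decomposition hs hu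
  rw [h2, h1, Finset.mul_sum]
  refine Finset.sum_lt_sum (fun t _ => mul_le_mul_of_nonneg_right t.2.le (by positivity)) ?_
  by_contra! hcon
  refine h0 (Subtype.ext ?_)
  rw [h0']
  refine Finset.sum_eq_zero fun t ht => ?_
  have h3 := hcon t ht
  by_contra hne
  have h4 : 0 < ‖f t‖ ^ 2 := by positivity
  have h5 : (t : ℝ) < μ := t.2
  nlinarith

variable [CompleteSpace H]

/-- The eigenvalues involved lie in `[m, μ]`, so `‖(T - m)u‖ ≤ (μ - m)‖u‖` on the span. As `u = R (T
- m)u`, the unit ball of the span lies in the closure of the image of a ball under the compact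
operator `R`, and is therefore totally bounded. -/
theorem finiteDimensional_eigenSpan {T : H →ₗ.[ℂ] H} (hT : IsSemiboundedDiscrete T)
    {I : Set ℝ} {μ : ℝ} (hI : I ⊆ Set.Iic μ) : FiniteDimensional ℂ (eigenSpan T I) := by
  obtain ⟨m, R, hm, hR, hRc, hb⟩ := hT.exists_real_resolvent μ
  have hT2 : ∀ u : T.domain, (u : H) ∈ eigenSpan T I →
      ‖T u - (m : ℂ) • (u : H)‖ ≤ (μ - m) * ‖(u : H)‖ := by
    intro u hu
    -- The form bound `hb` rules out eigenvalues below `m`. Two-sided control of `t - m` is needed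
    -- to compare squares.
    have hu' : (u : H) ∈ eigenSpan T (I ∩ Set.Ici m) := by
      refine (iSup₂_le fun t ht => ?_ : eigenSpan T I ≤ eigenSpan T (I ∩ Set.Ici m)) hu
      by_cases htm : m ≤ t
      · exact eigenspace_le_eigenSpan T ⟨ht, htm⟩
      · intro v hv
        obtain ⟨h, hv⟩ := mem_eigenspace.1 hv
        have h1 := hb ⟨v, h⟩
        rw [form_of_eigen hv] at h1
        simp only at h1
        have : v = 0 := by
          by_contra hne
          have h4 : 0 < ‖v‖ ^ 2 := by positivity
          nlinarith
        rw [this]; exact zero_mem _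
    obtain ⟨s, f, -, h1, -, h3⟩ := exists_eigen_decomposition hT.symm hu'
    refine abs_le_of_sq_le_sq' ?_ (by have := norm_nonneg (u : H); nlinarith) |>.2
    rw [h3, mul_pow, h1, Finset.mul_sum]
    refine Finset.sum_le_sum fun t _ => mul_le_mul_of_nonneg_right ?_ (by positivity)
    have h4 : (t : ℝ) ≤ μ := hI t.2.1
    have h5 : m ≤ (t : ℝ) := t.2.2
    exact pow_le_pow_left₀ (by linarith) (by linarith) 2
  refine FiniteDimensional.of_totallyBounded_nhds_zero ℂ
    (Metric.closedBall_mem_nhds (0 : eigenSpan T I) one_pos) ?_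
  have hcpt := hRc.isCompact_closure_image_closedBall (μ - m)
  refine (totallyBounded_preimage (f := ((↑) : eigenSpan T I → H))
    isUniformEmbedding_subtype_val.isUniformInducing hcpt.totallyBounded).subset ?_
  intro u hu
  have hdom := eigenSpan_le_domain T I u.2
  refine subset_closure ⟨T ⟨u, hdom⟩ - (m : ℂ) • (u : H), ?_, hR.2 ⟨u, hdom⟩⟩
  rw [mem_closedBall_zero_iff] at hu ⊢
  refine (hT2 ⟨u, hdom⟩ u.2).trans ?_
  have : ‖(u : H)‖ ≤ 1 := hu
  nlinarith

/-- For sets bounded above the closure in `spectralSubspace` is redundant, so its vectors lie in the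
domain and are finite sums of eigenvectors. -/
theorem spectralSubspace_eq_eigenSpan {T : H →ₗ.[ℂ] H} (hT : IsSemiboundedDiscrete T)
    {I : Set ℝ} {μ : ℝ} (hI : I ⊆ Set.Iic μ) : spectralSubspace T I = eigenSpan T I := by
  have := finiteDimensional_eigenSpan hT hI
  exact (Submodule.closed_of_finiteDimensional (eigenSpan T I)).submodule_topologicalClosure_eq

/-- A non-zero compact non-negative operator has its norm as an eigenvalue. -/
theorem exists_top_eigenvector (S : H →L[ℂ] H) (hSc : IsCompactOperator S)
    (hSs : ∀ x y, inner ℂ (S x) y = inner ℂ x (S y))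
    (hpos : ∀ x, 0 ≤ (inner ℂ x (S x)).re) (hS0 : S ≠ 0) :
    ∃ r : ℝ, 0 < r ∧ (∃ x, x ≠ 0 ∧ S x = (r : ℂ) • x) ∧
      ∀ v, ‖S v‖ ^ 2 ≤ r * (inner ℂ v (S v)).re := by
  have hSn : 0 < ‖S‖ := norm_pos_iff.2 hS0
  have : Nontrivial H := by
    by_contra hnt
    rw [not_nontrivial_iff_subsingleton] at hnt
    exact hS0 (ContinuousLinearMap.ext fun x => Subsingleton.elim _ _)
  obtain ⟨k, hk, hkn⟩ := spectrum.exists_nnnorm_eq_spectralRadius S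
  have hsa : IsSelfAdjoint S := (ContinuousLinearMap.isSelfAdjoint_iff_isSymmetric).2 hSs
  rw [S.spectralRadius_eq_nnnorm hsa, ENNReal.coe_inj] at hkn
  have hkn' : ‖k‖ = ‖S‖ := congrArg NNReal.toReal hkn
  have hk0 : k ≠ 0 := by rw [← norm_pos_iff, hkn']; exact hSn
  obtain ⟨x, hx⟩ := ((hSc.hasEigenvalue_iff_mem_spectrum hk0).2 hk).exists_hasEigenvector
  have hx0 : x ≠ 0 := hx.2
  have hSx : S x = k • x := hx.apply_eq_smul
  have hxpos : 0 < ‖x‖ ^ 2 := by positivity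
  -- Only `|k| = ‖S‖` is known so far. Symmetry makes `k` real and positivity excludes `-‖S‖`.
  have hkr : k = (‖S‖ : ℂ) := by
    have h1 := hSs x x
    rw [hSx, inner_smul_left, inner_smul_right, inner_self_eq_norm_sq_to_K] at h1
    have h2 : (((‖x‖ : ℝ) : ℂ) ^ 2) ≠ 0 := by exact_mod_cast hxpos.ne'
    have h3 : (starRingEnd ℂ) k = k := mul_right_cancel₀ h2 h1
    obtain ⟨r, rfl⟩ := Complex.conj_eq_iff_real.1 h3
    have h4 := hpos x
    rw [hSx, inner_smul_right, inner_self_eq_norm_sq_to_K, Complex.re_ofReal_mul] at h4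
    norm_cast at h4
    have h5 : 0 ≤ r := nonneg_of_mul_nonneg_left h4 hxpos
    rw [← hkn', Complex.norm_real, Real.norm_of_nonneg h5]
  exact ⟨‖S‖, hSn, ⟨x, hx0, by rw [hSx, hkr]⟩, norm_apply_sq_le S hSs hpos⟩

/-- On the orthogonal complement of the eigenvectors with eigenvalue in `I` the form is bounded
below by an eigenvalue outside `I`. -/
theorem exists_form_lower_bound {T : H →ₗ.[ℂ] H} (hT : IsSemiboundedDiscrete T) (I : Set ℝ) :
    (∀ u : T.domain, (u : H) ∈ (eigenSpan T I)ᗮ → u = 0) ∨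
    ∃ m, m ∉ I ∧ ∀ u : T.domain, (u : H) ∈ (eigenSpan T I)ᗮ → m * ‖(u : H)‖ ^ 2 ≤ form T u := by
  obtain ⟨m, R, -, hR, hRc, hb⟩ := hT.exists_real_resolvent 0
  have hsymm : ∀ x y, inner ℂ (R x) y = inner ℂ x (R y) := by
    intro x y
    obtain ⟨hx, h1⟩ := hR.1 x
    obtain ⟨hy, h2⟩ := hR.1 y
    have := hT.symm ⟨R x, hx⟩ ⟨R y, hy⟩
    nth_rewrite 1 [← h2]
    nth_rewrite 2 [← h1]
    simp only [inner_sub_left, inner_sub_right, inner_smul_left, inner_smul_right,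
      Complex.conj_ofReal]
    rw [this]
  have hform : ∀ v : H, ∀ h : R v ∈ T.domain, form T ⟨R v, h⟩ =
      m * ‖R v‖ ^ 2 + (inner ℂ (R v) v).re := by
    intro v h
    obtain ⟨_, h1⟩ := hR.1 v
    have h2 : T ⟨R v, h⟩ = v + (m : ℂ) • R v := by rw [← sub_eq_iff_eq_add]; exact h1
    rw [form, h2, inner_add_right, inner_smul_right, inner_self_eq_norm_sq_to_K, Complex.add_re,
      Complex.re_ofReal_mul]
    norm_cast
    exact add_comm _ _
  have hpos : ∀ v, 0 ≤ (inner ℂ v (R v)).re := by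
    intro v
    obtain ⟨h, -⟩ := hR.1 v
    have h1 := hb ⟨R v, h⟩
    rw [hform v h] at h1
    rw [← hsymm]
    simp only at h1
    have : 0 ≤ ‖R v‖ ^ 2 := by positivity
    linarith
  set K := (eigenSpan T I)ᗮ with hK
  have hmaps : ∀ w ∈ eigenSpan T I, R w ∈ eigenSpan T I := by
    intro w hw
    have : eigenSpan T I ≤ (eigenSpan T I).comap (R : H →ₗ[ℂ] H) := by
      refine iSup₂_le fun t ht v hv => ?_
      obtain ⟨h, hv'⟩ := mem_eigenspace.1 hv
      have h1 := hR.2 ⟨v, h⟩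
      rw [hv', ← sub_smul, map_smul] at h1
      by_cases h0 : (t : ℂ) - m = 0
      · rw [h0, zero_smul] at h1
        have : v = 0 := h1.symm
        rw [this]; exact zero_mem _
      · have : R v = ((t : ℂ) - m)⁻¹ • v := by
          rw [eq_inv_smul_iff₀ h0]; exact h1
        change R v ∈ eigenSpan T I
        rw [this]
        exact Submodule.smul_mem _ _ (eigenspace_le_eigenSpan T ht hv)
    exact this hw
  have hinv : ∀ v ∈ K, R v ∈ K := by
    intro v hv
    rw [hK, Submodule.mem_orthogonal] at hv ⊢
    intro w hw
    rw [← hsymm]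
    exact hv _ (hmaps w hw)
  have hdomK : ∀ u : T.domain, (u : H) ∈ K → T u - (m : ℂ) • (u : H) ∈ K := by
    intro u hu
    have hle : eigenSpan T I ≤ (ℂ ∙ (T u - (m : ℂ) • (u : H)))ᗮ := by
      refine iSup₂_le fun t ht v hv => ?_
      rw [Submodule.mem_orthogonal_singleton_iff_inner_left]
      have h0 : inner ℂ v (u : H) = 0 :=
        (Submodule.mem_orthogonal _ _).1 hu v (eigenspace_le_eigenSpan T ht hv)
      obtain ⟨h, hv'⟩ := mem_eigenspace.1 hv
      have := hT.symm ⟨v, h⟩ u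
      rw [hv', inner_smul_left, h0, mul_zero] at this
      rw [inner_sub_right, ← this, inner_smul_right, h0, mul_zero, sub_zero]
    rw [hK, Submodule.mem_orthogonal]
    intro w hw
    exact (Submodule.mem_orthogonal_singleton_iff_inner_left).1 (hle hw)
  -- By symmetry the complement `K` is invariant under `R` and receives `(T - m)u` for `u ∈ K ∩ dom
  -- T`. If the restriction vanishes, `u = R (T - m)u` forces `u = 0`. Otherwise its top eigenvalue
  -- `r` produces the lowest eigenvalue `m + 1/r` of `T` on `K`.
  let S : K →L[ℂ] K := R.restrict hinv
  have hSc : IsCompactOperator S := hRc.restrict' hinv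
  have hSs : ∀ x y : K, inner ℂ (S x) y = inner ℂ x (S y) := fun x y => hsymm x y
  by_cases hS0 : S = 0
  · left
    intro u hu
    have h1 := hR.2 u
    have h2 : (S ⟨_, hdomK u hu⟩ : H) = (u : H) := h1
    rw [hS0] at h2
    exact Subtype.ext h2.symm
  right
  obtain ⟨r, hr, ⟨x, hx, hSx'⟩, hSr⟩ := exists_top_eigenvector S hSc hSs (fun y => hpos y) hS0
  have hx0 : (x : H) ≠ 0 := fun h => hx (Subtype.ext h)
  have hSx : R x = (r : ℂ) • (x : H) := congrArg Subtype.val hSx'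
  have hr0 : (r : ℂ) ≠ 0 := by exact_mod_cast hr.ne'
  refine ⟨m + r⁻¹, ?_, ?_⟩
  -- An eigenvector for an eigenvalue in `I` would lie both in `K` and in `Kᗮ`.
  · intro hmI
    have hxe : (x : H) ∈ eigenspace T ((m + r⁻¹ : ℝ) : ℂ) := by
      obtain ⟨h, h1⟩ := hR.1 ((r : ℂ)⁻¹ • (x : H))
      have h2 : R ((r : ℂ)⁻¹ • (x : H)) = x := by rw [map_smul, hSx, inv_smul_smul₀ hr0]
      have hxd : (x : H) ∈ T.domain := h2 ▸ h
      refine mem_eigenspace.2 ⟨hxd, ?_⟩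
      have h3 : (⟨R ((r : ℂ)⁻¹ • (x : H)), h⟩ : T.domain) = ⟨x, hxd⟩ := Subtype.ext h2
      rw [h3, h2, sub_eq_iff_eq_add] at h1
      rw [h1]
      push_cast
      module
    have := (Submodule.mem_orthogonal _ _).1 x.2 _ (eigenspace_le_eigenSpan T hmI hxe)
    exact hx0 (inner_self_eq_zero.1 this)
  · intro u hu
    set v : K := ⟨_, hdomK u hu⟩ with hv
    have hRv : R v = u := hR.2 u
    have h1 := hSr v
    have h2 : ‖S v‖ = ‖(u : H)‖ := by rw [← hRv]; rfl
    have h3 : (inner ℂ v (S v)).re = (inner ℂ (R v) v).re := by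
      rw [hsymm]; rfl
    obtain ⟨h, -⟩ := hR.1 v
    have h4 := hform v h
    have h5 : (⟨R v, h⟩ : T.domain) = u := Subtype.ext hRv
    rw [h5, ← h3, hRv] at h4
    rw [h2] at h1
    have h6 : r⁻¹ * ‖(u : H)‖ ^ 2 ≤ (inner ℂ v (S v)).re := by
      rw [inv_mul_le_iff₀ hr]; exact h1
    linarith

end RationalPencil

namespace RationalPencil

variable {H : Type*} [NormedAddCommGroup H] [InnerProductSpace ℂ H]

/-! ### Counting eigenvalues by subspaces -/

theorem dimE_eq_finrank (V : Type*) [AddCommGroup V] [Module ℂ V] [FiniteDimensional ℂ V] :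
    dimE V = (Module.finrank ℂ V : ℕ∞) := by
  rw [dimE, ← Module.finrank_eq_rank, Cardinal.toENat_nat]

theorem dimE_mono {V : Type*} [AddCommGroup V] [Module ℂ V] {p q : Submodule ℂ V} (h : p ≤ q) :
    dimE p ≤ dimE q :=
  Cardinal.toENat.monotone' (Submodule.rank_mono h)

theorem exists_submodule_finrank_eq {E : Type*} [AddCommGroup E] [Module ℂ E]
    (V : Submodule ℂ E) {k : ℕ} (hk : k ≤ Module.finrank ℂ V) :
    ∃ V' ≤ V, FiniteDimensional ℂ V' ∧ Module.finrank ℂ V' = k := by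
  obtain ⟨f, hf⟩ := exists_linearIndependent_of_le_finrank hk
  have hf' : LinearIndependent ℂ (fun i => (f i : E)) := hf.map' V.subtype (Submodule.ker_subtype V)
  refine ⟨Submodule.span ℂ (Set.range fun i => (f i : E)), ?_, ?_, ?_⟩
  · rw [Submodule.span_le]
    rintro _ ⟨i, rfl⟩
    exact (f i).2
  · exact FiniteDimensional.span_of_finite ℂ (Set.finite_range _)
  · rw [finrank_span_eq_card hf', Fintype.card_fin]

theorem finrank_le_dimE_range {E F : Type*} [AddCommGroup E] [Module ℂ E] [AddCommGroup F]
    [Module ℂ F] (V : Submodule ℂ E) [FiniteDimensional ℂ V] (f : E →ₗ[ℂ] F)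
    (h : ∀ u ∈ V, f u = 0 → u = 0) : (Module.finrank ℂ V : ℕ∞) ≤ dimE (LinearMap.range f) := by
  have hinj : Function.Injective (f ∘ₗ V.subtype) := by
    rw [← LinearMap.ker_eq_bot, LinearMap.ker_eq_bot']
    exact fun u hu => Subtype.ext (h u u.2 hu)
  rw [← LinearMap.finrank_range_of_inj hinj, ← dimE_eq_finrank]
  exact dimE_mono (LinearMap.range_comp_le_range _ _)

/-- A subspace meeting the orthogonal complement of a finite-dimensional subspace trivially has
at most its dimension. -/
theorem finrank_le_of_orthogonal {D : Submodule ℂ H} (V : Submodule ℂ D) (W : Submodule ℂ H)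
    [FiniteDimensional ℂ W] (h : ∀ u ∈ V, (u : H) ∈ Wᗮ → u = 0) :
    FiniteDimensional ℂ V ∧ Module.finrank ℂ V ≤ Module.finrank ℂ W := by
  set f : V →ₗ[ℂ] W := (W.orthogonalProjectionOnto : H →ₗ[ℂ] W) ∘ₗ D.subtype ∘ₗ V.subtype
  have hinj : Function.Injective f := by
    rw [← LinearMap.ker_eq_bot, LinearMap.ker_eq_bot']
    intro u hu
    exact Subtype.ext (h u u.2 (Submodule.orthogonalProjectionOnto_eq_zero_iff.1 hu))
  exact ⟨FiniteDimensional.of_injective f hinj, LinearMap.finrank_le_finrank_of_injective hinj⟩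

/-- The number of eigenvalues of `T` below `μ`. -/
def numLT (T : H →ₗ.[ℂ] H) (μ : ℝ) : ℕ := Module.finrank ℂ (spectralSubspace T (Set.Iio μ))

/-- The number of eigenvalues of `T` not above `μ`. -/
def numLE (T : H →ₗ.[ℂ] H) (μ : ℝ) : ℕ := Module.finrank ℂ (spectralSubspace T (Set.Iic μ))

theorem finrank_comap_subtype {D W : Submodule ℂ H} (h : W ≤ D) :
    Module.finrank ℂ (W.comap D.subtype) = Module.finrank ℂ W :=
  (Submodule.comapSubtypeEquivOfLe h).finrank_eq

namespace IsSemiboundedDiscrete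

variable [CompleteSpace H] {T : H →ₗ.[ℂ] H} (hT : IsSemiboundedDiscrete T) (μ : ℝ)
include hT

theorem finiteDimensional_Iic : FiniteDimensional ℂ (spectralSubspace T (Set.Iic μ)) := by
  rw [spectralSubspace_eq_eigenSpan hT le_rfl]
  exact finiteDimensional_eigenSpan hT le_rfl

theorem finiteDimensional_Iio : FiniteDimensional ℂ (spectralSubspace T (Set.Iio μ)) := by
  rw [spectralSubspace_eq_eigenSpan hT Set.Iio_subset_Iic_self]
  exact finiteDimensional_eigenSpan hT Set.Iio_subset_Iic_self

theorem spectralSubspace_Iic_le_domain : spectralSubspace T (Set.Iic μ) ≤ T.domain := by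
  rw [spectralSubspace_eq_eigenSpan hT le_rfl]
  exact eigenSpan_le_domain T _

theorem dimE_Iio : dimE (spectralSubspace T (Set.Iio μ)) = numLT T μ :=
  haveI := hT.finiteDimensional_Iio μ
  dimE_eq_finrank _

theorem eigCount_eq : eigCount T μ = numLE T μ :=
  haveI := hT.finiteDimensional_Iic μ
  dimE_eq_finrank _

theorem finiteDimensional_eigenspace : FiniteDimensional ℂ (eigenspace T (μ : ℂ)) :=
  haveI := finiteDimensional_eigenSpan hT (le_refl (Set.Iic μ))
  Submodule.finiteDimensional_of_le (eigenspace_le_eigenSpan T (Set.mem_Iic.2 le_rfl))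

/-- The eigenspace at `μ` meets the span of the lower ones trivially, since the form equals `μ‖u‖²`
on the former and is strictly smaller at non-zero vectors of the latter. -/
theorem numLE_eq : numLE T μ = numLT T μ + Module.finrank ℂ (eigenspace T (μ : ℂ)) := by
  rw [numLE, numLT, spectralSubspace_eq_eigenSpan hT le_rfl,
    spectralSubspace_eq_eigenSpan hT Set.Iio_subset_Iic_self]
  have h1 : eigenSpan T (Set.Iic μ) = eigenSpan T (Set.Iio μ) ⊔ eigenspace T (μ : ℂ) := by
    refine le_antisymm (iSup₂_le fun t ht => ?_) (sup_le (eigenSpan_mono T Set.Iio_subset_Iic_self)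
      (eigenspace_le_eigenSpan T (Set.mem_Iic.2 le_rfl)))
    rcases (Set.mem_Iic.1 ht).lt_or_eq with h | h
    · exact (eigenspace_le_eigenSpan T (Set.mem_Iio.2 h)).trans le_sup_left
    · rw [h]; exact le_sup_right
  have h2 : eigenSpan T (Set.Iio μ) ⊓ eigenspace T (μ : ℂ) = ⊥ := by
    rw [Submodule.eq_bot_iff]
    rintro u ⟨hu1, hu2⟩
    obtain ⟨h, hu2⟩ := mem_eigenspace.1 hu2
    by_contra hne
    have := form_lt_of_mem_eigenSpan hT.symm (u := ⟨u, h⟩) hu1 (fun h0 => hne (congrArg Subtype.val h0))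
    rw [form_of_eigen hu2] at this
    exact lt_irrefl _ this
  have := finiteDimensional_eigenSpan hT (I := Set.Iio μ) Set.Iio_subset_Iic_self
  have := hT.finiteDimensional_eigenspace μ
  have h3 := Submodule.finrank_sup_add_finrank_inf_eq (eigenSpan T (Set.Iio μ)) (eigenspace T (μ : ℂ))
  rw [h2, finrank_bot, add_zero] at h3
  rw [h1, h3]

theorem exists_submodule_form_lt : ∃ V : Submodule ℂ T.domain, FiniteDimensional ℂ V ∧
    Module.finrank ℂ V = numLT T μ ∧ ∀ u ∈ V, u ≠ 0 → form T u < μ * ‖(u : H)‖ ^ 2 := by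
  have hle := eigenSpan_le_domain T (Set.Iio μ)
  have := finiteDimensional_eigenSpan hT (I := Set.Iio μ) Set.Iio_subset_Iic_self
  refine ⟨(eigenSpan T (Set.Iio μ)).comap T.domain.subtype, ?_, ?_, ?_⟩
  · exact Module.Finite.equiv (Submodule.comapSubtypeEquivOfLe hle).symm
  · rw [finrank_comap_subtype hle, numLT, spectralSubspace_eq_eigenSpan hT Set.Iio_subset_Iic_self]
  · exact fun u hu => form_lt_of_mem_eigenSpan hT.symm hu

theorem exists_submodule_form_le : ∃ V : Submodule ℂ T.domain, FiniteDimensional ℂ V ∧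
    Module.finrank ℂ V = numLE T μ ∧ ∀ u ∈ V, form T u ≤ μ * ‖(u : H)‖ ^ 2 := by
  have hle := eigenSpan_le_domain T (Set.Iic μ)
  have := finiteDimensional_eigenSpan hT (le_refl (Set.Iic μ))
  refine ⟨(eigenSpan T (Set.Iic μ)).comap T.domain.subtype, ?_, ?_, ?_⟩
  · exact Module.Finite.equiv (Submodule.comapSubtypeEquivOfLe hle).symm
  · rw [finrank_comap_subtype hle, numLE, spectralSubspace_eq_eigenSpan hT le_rfl]
  · exact fun u hu => form_le_of_mem_eigenSpan hT.symm hu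

/-- The lower bound from `exists_form_lower_bound` does not belong to `(-∞, μ]`, hence exceeds `μ`
strictly. If the complement contains no non-zero domain vector, any `ε` works. -/
theorem exists_gap : ∃ ε > 0, ∀ u : T.domain, (u : H) ∈ (spectralSubspace T (Set.Iic μ))ᗮ →
    (μ + ε) * ‖(u : H)‖ ^ 2 ≤ form T u := by
  rw [spectralSubspace_eq_eigenSpan hT le_rfl]
  rcases exists_form_lower_bound hT (Set.Iic μ) with h | ⟨m, hm, h⟩
  · refine ⟨1, one_pos, fun u hu => ?_⟩
    rw [h u hu, form]; simp
  · rw [Set.mem_Iic, not_le] at hm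
    exact ⟨m - μ, by linarith, fun u hu => by simpa using h u hu⟩

theorem form_ge_of_orthogonal (u : T.domain) (hu : (u : H) ∈ (spectralSubspace T (Set.Iio μ))ᗮ) :
    μ * ‖(u : H)‖ ^ 2 ≤ form T u := by
  rw [spectralSubspace_eq_eigenSpan hT Set.Iio_subset_Iic_self] at hu
  rcases exists_form_lower_bound hT (Set.Iio μ) with h | ⟨m, hm, h⟩
  · rw [h u hu, form]; simp
  · rw [Set.mem_Iio, not_lt] at hm
    exact (mul_le_mul_of_nonneg_right hm (by positivity)).trans (h u hu)

/-- Such a `V` meets the complement of the spectral subspace only in `0`. Together with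
`exists_submodule_form_lt` this identifies `numLT` as a maximal dimension. -/
theorem finrank_le_numLT (V : Submodule ℂ T.domain)
    (hV : ∀ u ∈ V, u ≠ 0 → form T u < μ * ‖(u : H)‖ ^ 2) :
    FiniteDimensional ℂ V ∧ Module.finrank ℂ V ≤ numLT T μ := by
  have := hT.finiteDimensional_Iio μ
  refine finrank_le_of_orthogonal V (spectralSubspace T (Set.Iio μ)) fun u hu huW => ?_
  by_contra hne
  exact (hV u hu hne).not_ge (hT.form_ge_of_orthogonal μ u huW)

/-- The non-strict hypothesis on `V` is compatible with a bound `≥ μ` on the complement, so the gap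
above `μ` is essential here. -/
theorem finrank_le_numLE (V : Submodule ℂ T.domain)
    (hV : ∀ u ∈ V, form T u ≤ μ * ‖(u : H)‖ ^ 2) :
    FiniteDimensional ℂ V ∧ Module.finrank ℂ V ≤ numLE T μ := by
  have := hT.finiteDimensional_Iic μ
  obtain ⟨ε, hε, hgap⟩ := hT.exists_gap μ
  refine finrank_le_of_orthogonal V (spectralSubspace T (Set.Iic μ)) fun u hu huW => ?_
  by_contra hne
  have h1 := hgap u huW
  have h2 := hV u hu
  have h3 : 0 < ‖(u : H)‖ ^ 2 := by
    have : (u : H) ≠ 0 := fun h => hne (Subtype.ext h)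
    positivity
  nlinarith

end IsSemiboundedDiscrete

/-- A positive continuous quadratic function on a finite-dimensional space is bounded below by a
multiple of the square of the norm. -/
theorem exists_pos_mul_norm_sq_le {V : Type*} [NormedAddCommGroup V] [NormedSpace ℂ V]
    [FiniteDimensional ℂ V] (f : V → ℝ) (hf : Continuous f)
    (hsmul : ∀ (r : ℝ) (u : V), f ((r : ℂ) • u) = r ^ 2 * f u)
    (hpos : ∀ u, u ≠ 0 → 0 < f u) : ∃ ε > 0, ∀ u, ε * ‖u‖ ^ 2 ≤ f u := by
  have h0 : f 0 = 0 := by simpa using hsmul 0 0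
  have : ProperSpace V := FiniteDimensional.proper ℂ V
  rcases subsingleton_or_nontrivial V with hV | hV
  · exact ⟨1, one_pos, fun u => by rw [Subsingleton.elim u 0, h0]; simp⟩
  obtain ⟨v, hv⟩ := exists_ne (0 : V)
  have hne : (Metric.sphere (0 : V) 1).Nonempty := by
    refine ⟨((‖v‖⁻¹ : ℝ) : ℂ) • v, ?_⟩
    rw [mem_sphere_zero_iff_norm, norm_smul, Complex.norm_real, norm_inv, norm_norm,
      inv_mul_cancel₀ (norm_ne_zero_iff.2 hv)]
  obtain ⟨w, hw, hmin⟩ := (isCompact_sphere (0 : V) 1).exists_isMinOn hne hf.continuousOn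
  have hw0 : w ≠ 0 := by
    rintro rfl
    simp at hw
  refine ⟨f w, hpos w hw0, fun u => ?_⟩
  by_cases hu : u = 0
  · rw [hu, h0]; simp
  have hun : 0 < ‖u‖ := norm_pos_iff.2 hu
  have h1 : f w ≤ f (((‖u‖⁻¹ : ℝ) : ℂ) • u) := hmin (by
    rw [mem_sphere_zero_iff_norm, norm_smul, Complex.norm_real, norm_inv, norm_norm,
      inv_mul_cancel₀ hun.ne'])
  rw [hsmul, inv_pow, inv_mul_eq_div, le_div_iff₀ (by positivity)] at h1
  exact h1

/-- The form of an unbounded operator is continuous on finite-dimensional subspaces. -/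
theorem continuous_form_restrict (T : H →ₗ.[ℂ] H) (V : Submodule ℂ T.domain)
    [FiniteDimensional ℂ V] : Continuous fun u : V => form T u := by
  have h1 : Continuous (T.toFun ∘ₗ V.subtype) := LinearMap.continuous_of_finiteDimensional _
  have h2 : Continuous fun u : V => ((u : T.domain) : H) :=
    continuous_subtype_val.comp continuous_subtype_val
  exact Complex.continuous_re.comp (h2.inner h1)

theorem form_smul (T : H →ₗ.[ℂ] H) (r : ℝ) (u : T.domain) :
    form T ((r : ℂ) • u) = r ^ 2 * form T u := by
  rw [form, T.map_smul, Submodule.coe_smul, inner_smul_left, inner_smul_right,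
    Complex.conj_ofReal, Complex.re_ofReal_mul, Complex.re_ofReal_mul, form]
  ring

end RationalPencil

namespace RationalPencil

/-! ### Enumerating the jumps of a counting function -/

/-- The jumps of a pair of counting functions `N ≤ M` (left- and right-continuous versions of each
other) on an interval are enumerated by a non-decreasing sequence. -/
theorem exists_jump_enumeration {I : Set ℝ} (hI : I.OrdConnected) (N M : ℝ → ℕ) {κ : ℕ} {α : ℝ}
    (hα : α ∈ I) (hMN : ∀ s ∈ I, ∀ t ∈ I, s < t → M s ≤ N t) (hNM : ∀ t ∈ I, N t ≤ M t)
    (hleft : ∀ t ∈ I, ∃ s ∈ I, s < t ∧ N t ≤ N s) (hright : ∀ t ∈ I, ∃ s ∈ I, t < s ∧ M s ≤ M t)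
    (hκα : ∀ t ∈ I, t < α → M t ≤ κ) (hκ : ∀ t ∈ I, κ ≤ N t) :
    ∃ (n : ℕ∞) (lam : ℕ → ℝ), (∀ j : ℕ, 1 ≤ j → (j : ℕ∞) ≤ n → lam j ∈ I) ∧
      (∀ i j : ℕ, 1 ≤ i → i ≤ j → (j : ℕ∞) ≤ n → lam i ≤ lam j) ∧
      (∀ t ∈ I, Set.encard {j : ℕ | 1 ≤ j ∧ (j : ℕ∞) ≤ n ∧ lam j = t} = (M t - N t : ℕ)) ∧
      (∀ t ∈ I, ∀ j : ℕ, 1 ≤ j → (j : ℕ∞) ≤ n → (lam j ≤ t ↔ j + κ ≤ M t)) ∧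
      (n = ⊤ ↔ ∀ k : ℕ, ∃ t ∈ I, k ≤ N t) := by
  have hN : ∀ s ∈ I, ∀ t ∈ I, s ≤ t → N s ≤ N t := by
    intro s hs t ht hst
    rcases hst.eq_or_lt with rfl | h
    · exact le_rfl
    · exact (hNM s hs).trans (hMN s hs t ht h)
  have hM : ∀ s ∈ I, ∀ t ∈ I, s ≤ t → M s ≤ M t := by
    intro s hs t ht hst
    rcases hst.eq_or_lt with rfl | h
    · exact le_rfl
    · exact (hMN s hs t ht h).trans (hNM t ht)
  -- The total number of jumps is the supremum of `N - κ`, possibly infinite. The value `lam j` is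
  -- then the first point where `M` reaches `j + κ`.
  set n : ℕ∞ := ⨆ t : I, ((N t - κ : ℕ) : ℕ∞) with hn
  have hle : ∀ j : ℕ, 1 ≤ j → ((j : ℕ∞) ≤ n ↔ ∃ t ∈ I, j + κ ≤ N t) := by
    intro j hj
    constructor
    · intro h
      by_contra! hcon
      have h1 : n ≤ ((j - 1 : ℕ) : ℕ∞) := iSup_le fun t => by
        have := hcon t t.2
        exact_mod_cast (by omega : N t - κ ≤ j - 1)
      have h2 : (j : ℕ∞) ≤ ((j - 1 : ℕ) : ℕ∞) := h.trans h1
      have h3 : j ≤ j - 1 := by exact_mod_cast h2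
      omega
    · rintro ⟨t, ht, h⟩
      refine le_trans ?_ (le_iSup (fun t : I => ((N t - κ : ℕ) : ℕ∞)) ⟨t, ht⟩)
      exact_mod_cast (by omega : j ≤ N t - κ)
  set F : ℕ → Set ℝ := fun j => {t | t ∈ I ∧ j + κ ≤ M t} with hF
  set lam : ℕ → ℝ := fun j => sInf (F j) with hlam
  -- Indexing from `1` matters: to the left of `α` one has `M ≤ κ < j + κ`.
  have hbdd : ∀ j, 1 ≤ j → ∀ t ∈ F j, α ≤ t := by
    rintro j hj t ⟨ht, h⟩
    by_contra! hlt
    have := hκα t ht hlt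
    omega
  have hbelow : ∀ j, 1 ≤ j → BddBelow (F j) := fun j hj => ⟨α, hbdd j hj⟩
  have hne : ∀ j : ℕ, 1 ≤ j → (j : ℕ∞) ≤ n → (F j).Nonempty := by
    intro j hj h
    obtain ⟨t, ht, h⟩ := (hle j hj).1 h
    exact ⟨t, ht, h.trans (hNM t ht)⟩
  have hmem : ∀ j : ℕ, 1 ≤ j → (j : ℕ∞) ≤ n → lam j ∈ F j := by
    intro j hj h
    obtain ⟨t, ht, h'⟩ := hne j hj h
    have h1 : lam j ∈ I :=
      hI.out hα ht ⟨le_csInf (hne j hj h) (hbdd j hj), csInf_le (hbelow j hj) ⟨ht, h'⟩⟩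
    -- Right-continuity of `M` makes the infimum a minimum.
    obtain ⟨s, hs, hlt, hMs⟩ := hright _ h1
    obtain ⟨r, hr, hrs⟩ := exists_lt_of_csInf_lt (hne j hj h) hlt
    exact ⟨h1, (hr.2.trans (hM r hr.1 s hs hrs.le)).trans hMs⟩
  have hiff : ∀ t ∈ I, ∀ j : ℕ, 1 ≤ j → (j : ℕ∞) ≤ n → (lam j ≤ t ↔ j + κ ≤ M t) := by
    intro t ht j hj hjn
    constructor
    · intro h
      exact (hmem j hj hjn).2.trans (hM _ (hmem j hj hjn).1 t ht h)
    · intro h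
      exact csInf_le (hbelow j hj) ⟨ht, h⟩
  have hiff' : ∀ t ∈ I, ∀ j : ℕ, 1 ≤ j → (j : ℕ∞) ≤ n → (lam j < t ↔ j + κ ≤ N t) := by
    intro t ht j hj hjn
    constructor
    · intro h
      exact (hmem j hj hjn).2.trans (hMN _ (hmem j hj hjn).1 t ht h)
    · intro h
      obtain ⟨s, hs, hst, hNs⟩ := hleft t ht
      exact ((hiff s hs j hj hjn).2 ((h.trans hNs).trans (hNM s hs))).trans_lt hst
  have hjn : ∀ t ∈ I, ∀ j : ℕ, 1 ≤ j → j + κ ≤ M t → (j : ℕ∞) ≤ n := by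
    intro t ht j hj h
    obtain ⟨s, hs, hts, -⟩ := hright t ht
    exact (hle j hj).2 ⟨s, hs, h.trans (hMN t ht s hs hts)⟩
  refine ⟨n, lam, fun j hj h => (hmem j hj h).1, ?_, ?_, hiff, ?_⟩
  · intro i j hi hij hj
    have h1 := hmem j (hi.trans hij) hj
    have hin : (i : ℕ∞) ≤ n := le_trans (by exact_mod_cast hij) hj
    exact (hiff _ h1.1 i hi hin).2 (le_trans (by omega) h1.2)
  · intro t ht
    -- By `hiff` and `hiff'`, `lam j = t` means `N t < j + κ ≤ M t`.
    have : {j : ℕ | 1 ≤ j ∧ (j : ℕ∞) ≤ n ∧ lam j = t} =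
        (Finset.Ioc (N t - κ) (M t - κ) : Finset ℕ) := by
      ext j
      simp only [Set.mem_ofPred_eq, Finset.coe_Ioc, Set.mem_Ioc]
      have h1 := hκ t ht
      have h2 := hNM t ht
      constructor
      · rintro ⟨hj, hjn', h⟩
        have h3 := (hiff t ht j hj hjn').1 h.le
        have h4 := mt (hiff' t ht j hj hjn').2 h.not_lt
        omega
      · rintro ⟨h3, h4⟩
        have hj : 1 ≤ j := by omega
        have h5 : j + κ ≤ M t := by omega
        have hjn' := hjn t ht j hj h5
        refine ⟨hj, hjn', ((hiff t ht j hj hjn').2 h5).antisymm ?_⟩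
        by_contra! h6
        have := (hiff' t ht j hj hjn').1 h6
        omega
    rw [this, Set.encard_coe_eq_coe_finsetCard, Nat.card_Ioc]
    congr 1
    have h1 := hκ t ht
    have h2 := hNM t ht
    omega
  · constructor
    · intro h k
      obtain ⟨t, ht, h'⟩ := (hle (k + 1) (by omega)).1 (by rw [h]; exact le_top)
      exact ⟨t, ht, by omega⟩
    · intro h
      rw [ENat.eq_top_iff_forall_ge]
      intro j
      obtain ⟨t, ht, h'⟩ := h (j + 1 + κ)
      exact le_trans (by exact_mod_cast (by omega : j ≤ j + 1)) ((hle (j + 1) (by omega)).2 ⟨t, ht, h'⟩)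

end RationalPencil

namespace RationalPencil

variable {H : Type*} [NormedAddCommGroup H] [InnerProductSpace ℂ H]

/-! ### The intervals between the poles -/

section Interval

variable {L : ℕ} {c : ℕ → ℝ}

theorem cExt_lt (hc : StrictMonoOn c (Set.Icc 1 L)) {l : ℕ} (hl : l ∈ Finset.Icc 1 (L + 1)) :
    cExt L c (l - 1) < cExt L c l := by
  rw [Finset.mem_Icc] at hl
  have h0 : l ≠ 0 := by omega
  by_cases h1 : l - 1 = 0
  · by_cases h2 : l ≤ L
    · simp [cExt, h1, h0, h2]
    · simp [cExt, h1, h0, h2]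
  · have h3 : l - 1 ≤ L := by omega
    by_cases h2 : l ≤ L
    · simp only [cExt, h1, h0, h2, h3, if_true, if_false, EReal.coe_lt_coe_iff]
      exact hc ⟨by omega, h3⟩ ⟨by omega, h2⟩ (by omega)
    · simp [cExt, h1, h0, h2, h3]

theorem isOpen_interval (l : ℕ) : IsOpen (interval L c l) :=
  (isOpen_lt continuous_const continuous_coe_real_ereal).inter
    (isOpen_lt continuous_coe_real_ereal continuous_const)

theorem ordConnected_interval (l : ℕ) : (interval L c l).OrdConnected :=
  ⟨fun _ hx _ hy _ hz => ⟨hx.1.trans_le (EReal.coe_le_coe_iff.2 hz.1),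
    (EReal.coe_le_coe_iff.2 hz.2).trans_lt hy.2⟩⟩

theorem exists_mem_interval_btwn {l : ℕ} {a b : EReal} (ha : cExt L c (l - 1) ≤ a)
    (hb : b ≤ cExt L c l) (hab : a < b) :
    ∃ t ∈ interval L c l, a < (t : EReal) ∧ (t : EReal) < b := by
  obtain ⟨t, h1, h2⟩ := EReal.lt_iff_exists_real_btwn.1 hab
  exact ⟨t, ⟨ha.trans_lt h1, h2.trans_le hb⟩, h1, h2⟩

theorem lt_of_mem_interval (hc : StrictMonoOn c (Set.Icc 1 L)) {l j : ℕ} {t : ℝ}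
    (hl : l ∈ Finset.Icc 1 (L + 1)) (ht : t ∈ interval L c l) (hj : j ∈ Finset.Icc 1 L)
    (hjl : j < l) : c j < t := by
  rw [Finset.mem_Icc] at hl hj
  have h1 := ht.1
  rw [cExt, if_neg (by omega), if_pos (by omega), EReal.coe_lt_coe_iff] at h1
  exact (hc.monotoneOn ⟨hj.1, hj.2⟩ ⟨by omega, by omega⟩ (by omega)).trans_lt h1

theorem gt_of_mem_interval (hc : StrictMonoOn c (Set.Icc 1 L)) {l j : ℕ} {t : ℝ}
    (hl : l ∈ Finset.Icc 1 (L + 1)) (ht : t ∈ interval L c l) (hj : j ∈ Finset.Icc 1 L)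
    (hjl : l ≤ j) : t < c j := by
  rw [Finset.mem_Icc] at hl hj
  have h1 := ht.2
  rw [cExt, if_neg (by omega), if_pos (by omega), EReal.coe_lt_coe_iff] at h1
  exact h1.trans_le (hc.monotoneOn ⟨by omega, by omega⟩ ⟨hj.1, hj.2⟩ hjl)

theorem ne_of_mem_interval (hc : StrictMonoOn c (Set.Icc 1 L)) {l j : ℕ} {t : ℝ}
    (hl : l ∈ Finset.Icc 1 (L + 1)) (ht : t ∈ interval L c l) (hj : j ∈ Finset.Icc 1 L) :
    t ≠ c j := by
  rcases lt_or_ge j l with h | h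
  · exact (lt_of_mem_interval hc hl ht hj h).ne'
  · exact (gt_of_mem_interval hc hl ht hj h).ne

theorem offPoles_of_mem_interval (hc : StrictMonoOn c (Set.Icc 1 L)) {l : ℕ} {t : ℝ}
    (hl : l ∈ Finset.Icc 1 (L + 1)) (ht : t ∈ interval L c l) : (t : ℂ) ∈ offPoles L c :=
  fun _ hj h => ne_of_mem_interval hc hl ht hj (Complex.ofReal_injective h)

theorem exists_mem_interval {t : ℝ} (ht : (t : ℂ) ∈ offPoles L c) :
    ∃ l ∈ Finset.Icc 1 (L + 1), t ∈ interval L c l := by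
  classical
  have hex : ∃ l, (t : EReal) < cExt L c l := ⟨L + 1, by simp [cExt]⟩
  have hspec := Nat.find_spec hex
  set l := Nat.find hex with hl
  have h0 : l ≠ 0 := by
    intro h
    rw [h] at hspec
    simp [cExt] at hspec
  have h1 : l ≤ L + 1 := Nat.find_min' hex (by simp [cExt])
  have h2 : cExt L c (l - 1) ≤ (t : EReal) := not_lt.1 (Nat.find_min hex (by omega))
  refine ⟨l, Finset.mem_Icc.2 ⟨by omega, h1⟩, h2.lt_of_ne ?_, hspec⟩
  intro h
  by_cases h3 : l - 1 = 0
  · simp [cExt, h3] at h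
  · rw [cExt, if_neg h3, if_pos (by omega), EReal.coe_eq_coe_iff] at h
    exact ht (l - 1) (Finset.mem_Icc.2 ⟨by omega, by omega⟩) (by rw [h])

end Interval

/-! ### The quadratic forms of the operator function -/

/-- The form of `A - t - ∑_{j ∈ s} Γ_j / (c_j - t)`. -/
def partialForm (A : H →ₗ.[ℂ] H) (Γ : ℕ → H →L[ℂ] H) (c : ℕ → ℝ) (s : Finset ℕ)
    (u : A.domain) (t : ℝ) : ℝ :=
  form A u - t * ‖(u : H)‖ ^ 2 - ∑ j ∈ s, (c j - t)⁻¹ * (inner ℂ (u : H) (Γ j u)).re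

theorem re_inner_sum_smul (Γ : ℕ → H →L[ℂ] H) (s : Finset ℕ) (a : ℕ → ℝ) (u : H) :
    (inner ℂ u ((∑ j ∈ s, ((a j : ℝ) : ℂ) • Γ j) u)).re =
      ∑ j ∈ s, a j * (inner ℂ u (Γ j u)).re := by
  simp

theorem schurForm_eq (A : H →ₗ.[ℂ] H) (L : ℕ) (Γ : ℕ → H →L[ℂ] H) (c : ℕ → ℝ) (u : A.domain)
    (t : ℝ) : schurForm A L Γ c u t = partialForm A Γ c (Finset.Icc 1 L) u t := by
  refine (form_vadd A (-((t : ℂ) • ContinuousLinearMap.id ℂ H)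
    - ∑ j ∈ Finset.Icc 1 L, ((c j : ℂ) - t)⁻¹ • Γ j) u).trans ?_
  rw [partialForm]
  have h := re_inner_sum_smul Γ (Finset.Icc 1 L) (fun j => (c j - t)⁻¹) (u : H)
  simp only [Complex.ofReal_sub, Complex.ofReal_inv] at h
  have h2 : (inner ℂ (u : H) ((t : ℂ) • (u : H))).re = t * ‖(u : H)‖ ^ 2 := by
    rw [inner_smul_right, inner_self_eq_norm_sq_to_K, Complex.re_ofReal_mul]
    norm_cast
  rw [sub_apply, neg_apply,
    smul_apply, inner_sub_right, inner_neg_right, Complex.sub_re,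
    Complex.neg_re, h, ContinuousLinearMap.id_apply, h2]
  ring

theorem form_shiftOp (A : H →ₗ.[ℂ] H) (L : ℕ) (Γ : ℕ → H →L[ℂ] H) (c : ℕ → ℝ) (l : ℕ)
    (u : A.domain) : form (shiftOp A L Γ c l) u - c (l - 1) * ‖(u : H)‖ ^ 2 =
      partialForm A Γ c (Finset.Icc l L) u (c (l - 1)) := by
  have e : form (shiftOp A L Γ c l) u = _ :=
    form_vadd A (-∑ j ∈ Finset.Icc l L, ((c j : ℂ) - (c (l - 1) : ℂ))⁻¹ • Γ j) u
  rw [e, partialForm]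
  have h := re_inner_sum_smul Γ (Finset.Icc l L) (fun j => (c j - c (l - 1))⁻¹) (u : H)
  simp only [Complex.ofReal_sub, Complex.ofReal_inv] at h
  rw [neg_apply, inner_neg_right, Complex.neg_re, h]
  ring

/-- The unbounded term `form A u` cancels in the difference, leaving bounded forms whose
coefficients are continuous in `t`. The estimate is therefore uniform over `dom A`. -/
theorem partialForm_close (A : H →ₗ.[ℂ] H) (Γ : ℕ → H →L[ℂ] H) (c : ℕ → ℝ) (s : Finset ℕ)
    {a : ℝ} (ha : ∀ j ∈ s, a ≠ c j) {ε : ℝ} (hε : 0 < ε) :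
    ∀ᶠ t in nhds a, ∀ u : A.domain,
      |partialForm A Γ c s u t - partialForm A Γ c s u a| ≤ ε * ‖(u : H)‖ ^ 2 := by
  set ω : ℝ → ℝ := fun t => |t - a| + ∑ j ∈ s, |(c j - t)⁻¹ - (c j - a)⁻¹| * ‖Γ j‖ with hω
  have hcont : ContinuousAt ω a := by
    refine ContinuousAt.add (by fun_prop) ?_
    refine tendsto_finsetSum _ fun j hj => ?_
    refine (ContinuousAt.abs (ContinuousAt.sub (ContinuousAt.inv₀ (by fun_prop) ?_)
      continuousAt_const)).mul continuousAt_const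
    exact sub_ne_zero.2 (ha j hj).symm
  have hω0 : ω a = 0 := by simp [hω]
  have hev : ∀ᶠ t in nhds a, ω t < ε := hcont.eventually_lt continuousAt_const (by rw [hω0]; exact hε)
  filter_upwards [hev] with t ht u
  refine le_trans ?_ (mul_le_mul_of_nonneg_right ht.le (by positivity))
  have h1 : partialForm A Γ c s u t - partialForm A Γ c s u a = -((t - a) * ‖(u : H)‖ ^ 2) -
      ∑ j ∈ s, ((c j - t)⁻¹ - (c j - a)⁻¹) * (inner ℂ (u : H) (Γ j u)).re := by
    simp only [partialForm, sub_mul, Finset.sum_sub_distrib]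
    ring
  rw [h1, hω, add_mul, Finset.sum_mul]
  refine (abs_sub _ _).trans (add_le_add ?_ ?_)
  · rw [abs_neg, abs_mul, abs_of_nonneg (by positivity : (0 : ℝ) ≤ ‖(u : H)‖ ^ 2)]
  · refine (Finset.abs_sum_le_sum_abs _ _).trans (Finset.sum_le_sum fun j _ => ?_)
    rw [abs_mul, mul_assoc]
    exact mul_le_mul_of_nonneg_left (re_inner_bounds _ _) (abs_nonneg _)

theorem partialForm_smul (A : H →ₗ.[ℂ] H) (Γ : ℕ → H →L[ℂ] H) (c : ℕ → ℝ) (s : Finset ℕ)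
    (t r : ℝ) (u : A.domain) :
    partialForm A Γ c s ((r : ℂ) • u) t = r ^ 2 * partialForm A Γ c s u t := by
  simp only [partialForm, form_smul, Submodule.coe_smul, norm_smul, map_smul, inner_smul_left,
    inner_smul_right, Complex.conj_ofReal, Complex.re_ofReal_mul, Complex.norm_real,
    Real.norm_eq_abs, mul_pow, sq_abs]
  have : ∑ j ∈ s, (c j - t)⁻¹ * (r * (r * (inner ℂ (u : H) (Γ j u)).re)) =
      r ^ 2 * ∑ j ∈ s, (c j - t)⁻¹ * (inner ℂ (u : H) (Γ j u)).re := by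
    rw [Finset.mul_sum]
    exact Finset.sum_congr rfl fun j _ => by ring
  rw [this]
  ring

theorem continuous_partialForm_restrict (A : H →ₗ.[ℂ] H) (Γ : ℕ → H →L[ℂ] H) (c : ℕ → ℝ)
    (s : Finset ℕ) (t : ℝ) (V : Submodule ℂ A.domain) [FiniteDimensional ℂ V] :
    Continuous fun u : V => partialForm A Γ c s u t := by
  have h2 : Continuous fun u : V => ((u : A.domain) : H) :=
    continuous_subtype_val.comp continuous_subtype_val
  refine ((continuous_form_restrict A V).sub (continuous_const.mul (h2.norm.pow 2))).sub ?_
  refine continuous_finsetSum _ fun j _ => continuous_const.mul ?_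
  exact Complex.continuous_re.comp (h2.inner ((Γ j).continuous.comp h2))

section Monotone

variable {A : H →ₗ.[ℂ] H} {Γ : ℕ → H →L[ℂ] H} {c : ℕ → ℝ}

/-- Each `1/(c_j - t)` increases as long as `[a, b]` does not contain `c_j`, and the term `-t‖u‖²`
supplies the definite rate. -/
theorem partialForm_anti {s : Finset ℕ} (hΓ : ∀ j ∈ s, ∀ u, 0 ≤ (inner ℂ u (Γ j u)).re)
    {a b : ℝ} (hab : a ≤ b) (hs : ∀ j ∈ s, b < c j ∨ c j < a) (u : A.domain) :
    partialForm A Γ c s u b ≤ partialForm A Γ c s u a - (b - a) * ‖(u : H)‖ ^ 2 := by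
  have : ∑ j ∈ s, (c j - a)⁻¹ * (inner ℂ (u : H) (Γ j u)).re ≤
      ∑ j ∈ s, (c j - b)⁻¹ * (inner ℂ (u : H) (Γ j u)).re := by
    refine Finset.sum_le_sum fun j hj => mul_le_mul_of_nonneg_right ?_ (hΓ j hj _)
    rcases hs j hj with h | h
    · exact inv_anti₀ (by linarith) (by linarith)
    · rw [← neg_sub a, ← neg_sub b, inv_neg, inv_neg]
      exact neg_le_neg (inv_anti₀ (by linarith) (by linarith))
  simp only [partialForm]
  linarith

/-- A pole to the left of `t` contributes `Γ_j/(t - c_j) ≥ 0`, so omitting it only lowers the form.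
-/
theorem partialForm_subset {s s' : Finset ℕ} (hss : s' ⊆ s)
    (hΓ : ∀ j ∈ s, ∀ u, 0 ≤ (inner ℂ u (Γ j u)).re) {t : ℝ}
    (hs : ∀ j ∈ s, j ∉ s' → c j < t) (u : A.domain) :
    partialForm A Γ c s' u t ≤ partialForm A Γ c s u t := by
  have : ∑ j ∈ s \ s', (c j - t)⁻¹ * (inner ℂ (u : H) (Γ j u)).re ≤ 0 := by
    refine Finset.sum_nonpos fun j hj => ?_
    rw [Finset.mem_sdiff] at hj
    refine mul_nonpos_of_nonpos_of_nonneg (inv_nonpos.2 ?_) (hΓ j hj.1 _)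
    linarith [hs j hj.1 hj.2]
  have h2 := Finset.sum_sdiff hss (f := fun j => (c j - t)⁻¹ * (inner ℂ (u : H) (Γ j u)).re)
  simp only [partialForm]
  linarith

variable {L : ℕ} (hΓ : ∀ l ∈ Finset.Icc 1 L, (Γ l).IsPositive)
  (hc : StrictMonoOn c (Set.Icc 1 L))
include hΓ hc

theorem schurForm_anti {l : ℕ} (hl : l ∈ Finset.Icc 1 (L + 1)) {a b : ℝ}
    (ha : a ∈ interval L c l) (hb : b ∈ interval L c l) (hab : a ≤ b) (u : A.domain) :
    schurForm A L Γ c u b ≤ schurForm A L Γ c u a - (b - a) * ‖(u : H)‖ ^ 2 := by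
  rw [schurForm_eq, schurForm_eq]
  refine partialForm_anti (fun j hj u => (hΓ j hj).re_inner_nonneg_right u) hab (fun j hj => ?_) u
  rcases lt_or_ge j l with h | h
  · exact Or.inr (lt_of_mem_interval hc hl ha hj h)
  · exact Or.inl (gt_of_mem_interval hc hl hb hj h)

theorem schurForm_strictAntiOn {l : ℕ} (hl : l ∈ Finset.Icc 1 (L + 1)) {u : A.domain}
    (hu : u ≠ 0) : StrictAntiOn (schurForm A L Γ c u) (interval L c l) := by
  intro a ha b hb hab
  have h1 := schurForm_anti hΓ hc hl ha hb hab.le u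
  have h2 : 0 < ‖(u : H)‖ ^ 2 := by
    have : (u : H) ≠ 0 := fun h => hu (Subtype.ext h)
    positivity
  nlinarith

omit hΓ in
theorem schurForm_close {l : ℕ} (hl : l ∈ Finset.Icc 1 (L + 1)) {a : ℝ}
    (ha : a ∈ interval L c l) {ε : ℝ} (hε : 0 < ε) :
    ∀ᶠ t in nhds a, ∀ u : A.domain,
      |schurForm A L Γ c u t - schurForm A L Γ c u a| ≤ ε * ‖(u : H)‖ ^ 2 := by
  simp only [schurForm_eq]
  exact partialForm_close A Γ c _ (fun j hj => ne_of_mem_interval hc hl ha hj) hε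

omit hΓ in
theorem continuousOn_schurForm {l : ℕ} (hl : l ∈ Finset.Icc 1 (L + 1)) (u : A.domain) :
    ContinuousOn (schurForm A L Γ c u) (interval L c l) := by
  intro a ha
  refine ContinuousAt.continuousWithinAt ?_
  rw [Metric.continuousAt_iff']
  intro ε hε
  have hpos : 0 < ε / (‖(u : H)‖ ^ 2 + 1) := by positivity
  filter_upwards [schurForm_close (A := A) (Γ := Γ) hc hl ha hpos] with t ht
  rw [Real.dist_eq]
  refine (ht u).trans_lt ?_
  rw [div_mul_eq_mul_div, div_lt_iff₀ (by positivity)]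
  nlinarith [sq_nonneg ‖(u : H)‖]

omit hΓ in
/-- The three cases in the definition of the Rayleigh functional. -/
theorem rayleigh_trichotomy {l : ℕ} (hl : l ∈ Finset.Icc 1 (L + 1)) (u : A.domain) :
    (∃ t ∈ interval L c l, schurForm A L Γ c u t = 0 ∧ rayleigh A L Γ c l u = (t : EReal)) ∨
    ((∀ t ∈ interval L c l, schurForm A L Γ c u t < 0) ∧
      rayleigh A L Γ c l u = cExt L c (l - 1)) ∨
    ((∀ t ∈ interval L c l, 0 < schurForm A L Γ c u t) ∧
      rayleigh A L Γ c l u = cExt L c l) := by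
  obtain ⟨a, ha, -⟩ := exists_mem_interval_btwn le_rfl le_rfl (cExt_lt hc hl)
  by_cases h : ∃ t : ℝ, t ∈ interval L c l ∧ schurForm A L Γ c u t = 0
  · left
    exact ⟨h.choose, h.choose_spec.1, h.choose_spec.2, by rw [rayleigh, dif_pos h]⟩
  right
  by_cases h' : ∀ t ∈ interval L c l, schurForm A L Γ c u t < 0
  · left
    exact ⟨h', by rw [rayleigh, dif_neg h, if_pos h']⟩
  right
  refine ⟨?_, by rw [rayleigh, dif_neg h, if_neg h']⟩
  push Not at h h'
  obtain ⟨s, hs, h0⟩ := h'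
  intro t ht
  by_contra! hneg
  obtain ⟨r, hr, hr0⟩ := (ordConnected_interval l).isPreconnected.intermediate_value ht hs
    (continuousOn_schurForm hc hl u) ⟨hneg, h0⟩
  exact h r hr hr0

/-- With its strict version, this replaces `p_l` by the sign of the form. The endpoint values of
`p_l` lie on the correct side of every `t` in the interval, so all three cases agree. -/
theorem rayleigh_le_iff {l : ℕ} (hl : l ∈ Finset.Icc 1 (L + 1)) {u : A.domain} (hu : u ≠ 0)
    {t : ℝ} (ht : t ∈ interval L c l) :
    rayleigh A L Γ c l u ≤ (t : EReal) ↔ schurForm A L Γ c u t ≤ 0 := by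
  rcases rayleigh_trichotomy (A := A) (Γ := Γ) hc hl u with ⟨s, hs, h0, h⟩ | ⟨h0, h⟩ | ⟨h0, h⟩
  · rw [h, EReal.coe_le_coe_iff, ← h0]
    exact ((schurForm_strictAntiOn hΓ hc hl hu).le_iff_ge ht hs).symm
  · rw [h]
    exact iff_of_true ht.1.le (h0 t ht).le
  · rw [h]
    exact iff_of_false ht.2.not_ge (h0 t ht).not_ge

theorem rayleigh_lt_iff {l : ℕ} (hl : l ∈ Finset.Icc 1 (L + 1)) {u : A.domain} (hu : u ≠ 0)
    {t : ℝ} (ht : t ∈ interval L c l) :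
    rayleigh A L Γ c l u < (t : EReal) ↔ schurForm A L Γ c u t < 0 := by
  rcases rayleigh_trichotomy (A := A) (Γ := Γ) hc hl u with ⟨s, hs, h0, h⟩ | ⟨h0, h⟩ | ⟨h0, h⟩
  · rw [h, EReal.coe_lt_coe_iff, ← h0]
    exact ((schurForm_strictAntiOn hΓ hc hl hu).lt_iff_gt ht hs).symm
  · rw [h]
    exact iff_of_true ht.1 (h0 t ht)
  · rw [h]
    exact iff_of_false ht.2.not_gt (h0 t ht).not_gt

omit hΓ in
theorem cExt_le_rayleigh {l : ℕ} (hl : l ∈ Finset.Icc 1 (L + 1)) (u : A.domain) :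
    cExt L c (l - 1) ≤ rayleigh A L Γ c l u ∧ rayleigh A L Γ c l u ≤ cExt L c l := by
  rcases rayleigh_trichotomy (A := A) (Γ := Γ) hc hl u with ⟨s, hs, h0, h⟩ | ⟨h0, h⟩ | ⟨h0, h⟩
  · rw [h]; exact ⟨hs.1.le, hs.2.le⟩
  · rw [h]; exact ⟨le_rfl, (cExt_lt hc hl).le⟩
  · rw [h]; exact ⟨(cExt_lt hc hl).le, le_rfl⟩

end Monotone

end RationalPencil

namespace RationalPencil

variable {H : Type*} [NormedAddCommGroup H] [InnerProductSpace ℂ H]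

/-! ### The operator function between its poles -/

theorem IsSemiboundedDiscrete.of_isSelfAdjoint [CompleteSpace H] {A : H →ₗ.[ℂ] H}
    (hA : IsSelfAdjoint A) (hbelow : IsBoundedBelow A) (hcomp : HasCompactResolvent A) :
    IsSemiboundedDiscrete A := by
  refine ⟨fun x y => ?_, hbelow, hcomp⟩
  have h := LinearPMap.adjoint_isFormalAdjoint (T := A) hA.dense_domain
  rw [LinearPMap.isSelfAdjoint_def.1 hA] at h
  exact h x y

/-- The gap above `μ` lets the level rise by `ε` without admitting larger subspaces. This absorbs
small form perturbations. -/
theorem IsSemiboundedDiscrete.exists_stable [CompleteSpace H] {T : H →ₗ.[ℂ] H}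
    (hT : IsSemiboundedDiscrete T) (μ : ℝ) : ∃ ε > 0, ∀ V : Submodule ℂ T.domain,
      (∀ u ∈ V, u ≠ 0 → form T u < (μ + ε) * ‖(u : H)‖ ^ 2) →
      FiniteDimensional ℂ V ∧ Module.finrank ℂ V ≤ numLE T μ := by
  have := hT.finiteDimensional_Iic μ
  obtain ⟨ε, hε, hgap⟩ := hT.exists_gap μ
  refine ⟨ε, hε, fun V hV => finrank_le_of_orthogonal V (spectralSubspace T (Set.Iic μ))
    fun u hu huW => ?_⟩
  by_contra hne
  exact (hV u hu hne).not_ge (hgap u huW)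

theorem norm_sq_pos_of_ne_zero {D : Submodule ℂ H} {u : D} (hu : u ≠ 0) :
    0 < ‖(u : H)‖ ^ 2 := by
  have : (u : H) ≠ 0 := fun h => hu (Subtype.ext h)
  positivity

variable {A : H →ₗ.[ℂ] H} {L : ℕ} {Γ : ℕ → H →L[ℂ] H} {c : ℕ → ℝ}

section Spectrum

theorem schur_apply (z : ℂ) (u : A.domain) : schur A L Γ c z u =
    A u - z • (u : H) - ∑ l ∈ Finset.Icc 1 L, ((c l : ℂ) - z)⁻¹ • Γ l u := by
  have : schur A L Γ c z u = (-(z • ContinuousLinearMap.id ℂ H)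
    - ∑ l ∈ Finset.Icc 1 L, ((c l : ℂ) - z)⁻¹ • Γ l : H →L[ℂ] H) u + A u := rfl
  rw [this]
  simp
  abel

variable [CompleteSpace H] (hA : IsSemiboundedDiscrete A)
  (hΓ : ∀ l ∈ Finset.Icc 1 L, (Γ l).IsPositive)
include hA

/-- `S(z)` is a bounded perturbation of `A`, so by compactness of the resolvent injectivity already
gives a bounded inverse. -/
theorem zero_mem_resolventSet_schur_iff (z : ℂ) :
    (0 : ℂ) ∈ resolventSet (schur A L Γ c z) ↔ eigenspace (schur A L Γ c z) 0 = ⊥ := by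
  constructor
  · rintro ⟨R, hR⟩
    rw [Submodule.eq_bot_iff]
    intro u hu
    obtain ⟨h, hu⟩ := mem_eigenspace.1 hu
    have := hR.2 ⟨u, h⟩
    rw [hu] at this
    simpa using this.symm
  · intro h
    obtain ⟨R, hR, -⟩ := exists_isResolventAt_vadd hA.compact _ h
    exact ⟨R, hR⟩

theorem pencilSpectrum_eq : pencilSpectrum A L Γ c = pencilPointSpectrum A L Γ c := by
  ext z
  simp only [pencilSpectrum, pencilPointSpectrum, Set.mem_ofPred_eq,
    zero_mem_resolventSet_schur_iff hA]

include hΓ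

omit [CompleteSpace H] in
-- The imaginary part of `(S(z)u, u) = 0` reads `Im z · (‖u‖² + ∑ |c_l - z|⁻² (Γ_l u, u)) = 0`, with
-- a positive second factor.
theorem im_eq_zero_of_mem_pencilPointSpectrum {z : ℂ} (hz : z ∈ pencilPointSpectrum A L Γ c) :
    z.im = 0 := by
  obtain ⟨-, hz⟩ := hz
  obtain ⟨u, hu, hu0⟩ := Submodule.exists_mem_ne_zero_of_ne_bot hz
  obtain ⟨h, hu⟩ := mem_eigenspace.1 hu
  have h1 : inner ℂ u (schur A L Γ c z ⟨u, h⟩) = 0 := by rw [hu]; simp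
  change inner ℂ u (schur A L Γ c z (⟨u, h⟩ : A.domain)) = 0 at h1
  rw [schur_apply] at h1
  simp only [inner_sub_right, inner_smul_right, inner_sum] at h1
  have hAim : (inner ℂ u (A ⟨u, h⟩)).im = 0 := by
    have h2 := hA.symm ⟨u, h⟩ ⟨u, h⟩
    rw [← inner_conj_symm] at h2
    exact Complex.conj_eq_iff_im.1 h2
  have hΓim : ∀ l ∈ Finset.Icc 1 L, inner ℂ u (Γ l u) = (((inner ℂ u (Γ l u)).re : ℝ) : ℂ) := by
    intro l hl
    have h2 : inner ℂ (Γ l u) u = inner ℂ u (Γ l u) := (hΓ l hl).isSymmetric u u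
    rw [← inner_conj_symm] at h2
    exact (Complex.conj_eq_iff_re.1 h2).symm
  have h3 := congrArg Complex.im h1
  have h4 : (z * inner ℂ u u).im = z.im * ‖u‖ ^ 2 := by
    have h2 : inner ℂ u u = ((‖u‖ ^ 2 : ℝ) : ℂ) := by
      rw [inner_self_eq_norm_sq_to_K]; norm_cast
    rw [h2, Complex.im_mul_ofReal]
  have h5 : ∀ l ∈ Finset.Icc 1 L, (((c l : ℂ) - z)⁻¹ * inner ℂ u (Γ l u)).im =
      z.im * ((Complex.normSq ((c l : ℂ) - z))⁻¹ * (inner ℂ u (Γ l u)).re) := by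
    intro l hl
    rw [hΓim l hl, Complex.im_mul_ofReal, Complex.inv_im]
    simp
    ring
  rw [Complex.sub_im, Complex.sub_im, hAim, h4, Complex.im_sum, Finset.sum_congr rfl h5,
    ← Finset.mul_sum, Complex.zero_im] at h3
  have h6 : 0 ≤ ∑ l ∈ Finset.Icc 1 L,
      (Complex.normSq ((c l : ℂ) - z))⁻¹ * (inner ℂ u (Γ l u)).re :=
    Finset.sum_nonneg fun l hl => mul_nonneg (inv_nonneg.2 (Complex.normSq_nonneg _))
      ((hΓ l hl).re_inner_nonneg_right u)
  have h7 : 0 < ‖u‖ ^ 2 := by positivity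
  have h8 : z.im * (‖u‖ ^ 2 + ∑ l ∈ Finset.Icc 1 L,
      (Complex.normSq ((c l : ℂ) - z))⁻¹ * (inner ℂ u (Γ l u)).re) = 0 := by linarith
  exact (mul_eq_zero.1 h8).resolve_right (by positivity)

theorem isSemiboundedDiscrete_schur (t : ℝ) : IsSemiboundedDiscrete (schur A L Γ c (t : ℂ)) := by
  refine isSemiboundedDiscrete_vadd hA _ fun x y => ?_
  have h : ∀ l ∈ Finset.Icc 1 L, inner ℂ (Γ l x) y = inner ℂ x (Γ l y) :=
    fun l hl => (hΓ l hl).isSymmetric x y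
  simp only [sub_apply, neg_apply, smul_apply, ContinuousLinearMap.id_apply,
    sum_apply, inner_sub_left, inner_sub_right, inner_neg_left,
    inner_neg_right, inner_smul_left, inner_smul_right, sum_inner, inner_sum, map_inv₀, map_sub,
    Complex.conj_ofReal]
  rw [Finset.sum_congr rfl fun l hl => by rw [h l hl]]

end Spectrum

/-- The number of negative eigenvalues of `S(t)`. -/
def negCount (A : H →ₗ.[ℂ] H) (L : ℕ) (Γ : ℕ → H →L[ℂ] H) (c : ℕ → ℝ) (t : ℝ) : ℕ :=
  numLT (schur A L Γ c (t : ℂ)) 0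

/-- The number of non-positive eigenvalues of `S(t)`. -/
def nonposCount (A : H →ₗ.[ℂ] H) (L : ℕ) (Γ : ℕ → H →L[ℂ] H) (c : ℕ → ℝ) (t : ℝ) : ℕ :=
  numLE (schur A L Γ c (t : ℂ)) 0

/-- The index shift: the smallest number of negative eigenvalues of `S(t)` in the interval. -/
def indexShift (A : H →ₗ.[ℂ] H) (L : ℕ) (Γ : ℕ → H →L[ℂ] H) (c : ℕ → ℝ) (l : ℕ) : ℕ :=
  sInf (negCount A L Γ c '' interval L c l)

theorem indexShift_le {l : ℕ} {t : ℝ} (ht : t ∈ interval L c l) :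
    indexShift A L Γ c l ≤ negCount A L Γ c t :=
  Nat.sInf_le ⟨t, ht, rfl⟩

theorem exists_negCount_eq_indexShift (hc : StrictMonoOn c (Set.Icc 1 L)) {l : ℕ}
    (hl : l ∈ Finset.Icc 1 (L + 1)) :
    ∃ t ∈ interval L c l, negCount A L Γ c t = indexShift A L Γ c l := by
  obtain ⟨a, ha, -⟩ := exists_mem_interval_btwn le_rfl le_rfl (cExt_lt hc hl)
  exact Nat.sInf_mem (⟨_, a, ha, rfl⟩ : (negCount A L Γ c '' interval L c l).Nonempty)

section Count

variable [CompleteSpace H] (hA : IsSemiboundedDiscrete A)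
  (hΓ : ∀ l ∈ Finset.Icc 1 L, (Γ l).IsPositive)
include hA hΓ

theorem exists_submodule_schurForm_neg (t : ℝ) : ∃ V : Submodule ℂ A.domain,
    FiniteDimensional ℂ V ∧ Module.finrank ℂ V = negCount A L Γ c t ∧
      ∀ u ∈ V, u ≠ 0 → schurForm A L Γ c u t < 0 := by
  obtain ⟨V, h1, h2, h3⟩ := (isSemiboundedDiscrete_schur hA hΓ (c := c) t).exists_submodule_form_lt 0
  exact ⟨V, h1, h2, fun u hu hu0 => (h3 u hu hu0).trans_eq (zero_mul _)⟩

theorem exists_submodule_schurForm_nonpos (t : ℝ) : ∃ V : Submodule ℂ A.domain,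
    FiniteDimensional ℂ V ∧ Module.finrank ℂ V = nonposCount A L Γ c t ∧
      ∀ u ∈ V, schurForm A L Γ c u t ≤ 0 := by
  obtain ⟨V, h1, h2, h3⟩ := (isSemiboundedDiscrete_schur hA hΓ (c := c) t).exists_submodule_form_le 0
  exact ⟨V, h1, h2, fun u hu => (h3 u hu).trans_eq (zero_mul _)⟩

theorem finrank_le_negCount (t : ℝ) (V : Submodule ℂ A.domain)
    (hV : ∀ u ∈ V, u ≠ 0 → schurForm A L Γ c u t < 0) :
    Module.finrank ℂ V ≤ negCount A L Γ c t :=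
  ((isSemiboundedDiscrete_schur hA hΓ (c := c) t).finrank_le_numLT 0 V
    fun u hu hu0 => (hV u hu hu0).trans_eq (zero_mul _).symm).2

theorem nonposCount_eq (t : ℝ) : nonposCount A L Γ c t = negCount A L Γ c t +
    Module.finrank ℂ (eigenspace (schur A L Γ c (t : ℂ)) 0) := by
  have := (isSemiboundedDiscrete_schur hA hΓ (c := c) t).numLE_eq 0
  rwa [Complex.ofReal_zero] at this

theorem dimE_eigenspace (t : ℝ) : dimE (eigenspace (schur A L Γ c (t : ℂ)) 0) =
    (nonposCount A L Γ c t - negCount A L Γ c t : ℕ) := by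
  have := (isSemiboundedDiscrete_schur hA hΓ (c := c) t).finiteDimensional_eigenspace 0
  rw [Complex.ofReal_zero] at this
  rw [dimE_eq_finrank, nonposCount_eq hA hΓ t, Nat.add_sub_cancel_left]

variable (hc : StrictMonoOn c (Set.Icc 1 L)) {l : ℕ} (hl : l ∈ Finset.Icc 1 (L + 1))
include hc hl

/-- A subspace on which the form is non-positive at `s` becomes strictly negative at every later
`t`. -/
theorem nonposCount_le_negCount {s t : ℝ} (hs : s ∈ interval L c l) (ht : t ∈ interval L c l)
    (hst : s < t) : nonposCount A L Γ c s ≤ negCount A L Γ c t := by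
  obtain ⟨V, -, h2, h3⟩ := exists_submodule_schurForm_nonpos hA hΓ (c := c) s
  rw [← h2]
  exact finrank_le_negCount hA hΓ t V fun u hu hu0 =>
    (schurForm_strictAntiOn hΓ hc hl hu0 hs ht hst).trans_le (h3 u hu)

/-- Left-continuity of `negCount`: on a finite-dimensional space a negative form is at most
`-ε‖u‖²`, which survives a small decrease of `t`. -/
theorem exists_lt_negCount_le {t : ℝ} (ht : t ∈ interval L c l) :
    ∃ s ∈ interval L c l, s < t ∧ negCount A L Γ c t ≤ negCount A L Γ c s := by
  obtain ⟨V, h1, h2, h3⟩ := exists_submodule_schurForm_neg hA hΓ (c := c) t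
  obtain ⟨ε, hε, hV⟩ := exists_pos_mul_norm_sq_le (V := V)
    (fun u => -partialForm A Γ c (Finset.Icc 1 L) u t)
    (continuous_partialForm_restrict A Γ c _ t V).neg
    (fun r u => by rw [Submodule.coe_smul, partialForm_smul]; ring)
    (fun u hu => by
      have := h3 u u.2 (fun h => hu (Subtype.ext h))
      rw [schurForm_eq] at this
      linarith)
  have hev := schurForm_close (A := A) (Γ := Γ) hc hl ht (half_pos hε)
  have hev2 : ∀ᶠ s in nhds t, s ∈ interval L c l := (isOpen_interval l).mem_nhds ht
  obtain ⟨s, ⟨hs1, hs2⟩, hst⟩ := (((hev.and hev2).filter_mono nhdsWithin_le_nhds).and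
    (self_mem_nhdsWithin : Set.Iio t ∈ nhdsWithin t (Set.Iio t))).exists
  refine ⟨s, hs2, hst, ?_⟩
  rw [← h2]
  refine finrank_le_negCount hA hΓ s V fun u hu hu0 => ?_
  have h4 := (abs_le.1 (hs1 u)).2
  have h5 := hV ⟨u, hu⟩
  have h6 := norm_sq_pos_of_ne_zero hu0
  simp only [← schurForm_eq] at h5
  change ε * ‖(u : H)‖ ^ 2 ≤ _ at h5
  nlinarith

/-- Right-continuity of `nonposCount`: a form that is non-positive at `s` is below `ε‖u‖²` at the
nearby point `t`, and the gap of `S(t)` above zero limits the dimension. -/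
theorem exists_gt_nonposCount_le {t : ℝ} (ht : t ∈ interval L c l) :
    ∃ s ∈ interval L c l, t < s ∧ nonposCount A L Γ c s ≤ nonposCount A L Γ c t := by
  obtain ⟨ε, hε, hV⟩ := (isSemiboundedDiscrete_schur hA hΓ (c := c) t).exists_stable 0
  have hev := schurForm_close (A := A) (Γ := Γ) hc hl ht (half_pos hε)
  have hev2 : ∀ᶠ s in nhds t, s ∈ interval L c l := (isOpen_interval l).mem_nhds ht
  obtain ⟨s, ⟨hs1, hs2⟩, hst⟩ := (((hev.and hev2).filter_mono nhdsWithin_le_nhds).and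
    (self_mem_nhdsWithin : Set.Ioi t ∈ nhdsWithin t (Set.Ioi t))).exists
  refine ⟨s, hs2, hst, ?_⟩
  obtain ⟨V, -, h2, h3⟩ := exists_submodule_schurForm_nonpos hA hΓ (c := c) s
  rw [← h2]
  refine (hV V fun u hu hu0 => ?_).2
  have h4 := (abs_le.1 (hs1 u)).1
  have h5 := h3 u hu
  have h6 := norm_sq_pos_of_ne_zero (D := A.domain) hu0
  change schurForm A L Γ c u t < _
  nlinarith

theorem nonposCount_le_indexShift {α t : ℝ} (hα : α ∈ interval L c l)
    (hκ : negCount A L Γ c α = indexShift A L Γ c l) (ht : t ∈ interval L c l) (hlt : t < α) :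
    nonposCount A L Γ c t ≤ indexShift A L Γ c l :=
  hκ ▸ nonposCount_le_negCount hA hΓ hc hl ht hα hlt

end Count

/-! ### The min-max principle -/

section MinMax

variable (hΓ : ∀ l ∈ Finset.Icc 1 L, (Γ l).IsPositive)
  (hc : StrictMonoOn c (Set.Icc 1 L)) {l : ℕ} (hl : l ∈ Finset.Icc 1 (L + 1))
include hΓ hc hl

/-- Real levels inside the interval suffice for comparison, because one fits strictly between any
two distinct values of `p_l`. -/
theorem rayleigh_le_rayleigh {u v : A.domain} (hu : u ≠ 0) (hv : v ≠ 0)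
    (h : ∀ t ∈ interval L c l, schurForm A L Γ c v t ≤ 0 → schurForm A L Γ c u t ≤ 0) :
    rayleigh A L Γ c l u ≤ rayleigh A L Γ c l v := by
  by_contra! hlt
  obtain ⟨t, ht, h1, h2⟩ := exists_mem_interval_btwn
    (cExt_le_rayleigh (A := A) (Γ := Γ) hc hl v).1
    (cExt_le_rayleigh (A := A) (Γ := Γ) hc hl u).2 hlt
  exact h2.not_ge ((rayleigh_le_iff hΓ hc hl hu ht).2 (h t ht ((rayleigh_le_iff hΓ hc hl hv ht).1 h1.le)))

theorem rayleigh_smul_eq {r : ℝ} (hr : r ≠ 0) {u : A.domain} (hu : u ≠ 0) :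
    rayleigh A L Γ c l ((r : ℂ) • u) = rayleigh A L Γ c l u := by
  have hru : (r : ℂ) • u ≠ 0 := smul_ne_zero (by exact_mod_cast hr) hu
  have hiff : ∀ t, schurForm A L Γ c ((r : ℂ) • u) t ≤ 0 ↔ schurForm A L Γ c u t ≤ 0 := by
    intro t
    have : 0 < r ^ 2 := by positivity
    rw [schurForm_eq, schurForm_eq, partialForm_smul]
    constructor <;> intro h <;> nlinarith
  exact le_antisymm (rayleigh_le_rayleigh hΓ hc hl hru hu fun t _ => (hiff t).2)
    (rayleigh_le_rayleigh hΓ hc hl hu hru fun t _ => (hiff t).1)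

/-- By homogeneity only the unit sphere of `V` matters, and it is compact. On it `p_l` is upper
semicontinuous, since `p_l(u) < t` is the open condition `(S(t)u, u) < 0`. An upper semicontinuous
function on a non-empty compact set attains its maximum. -/
theorem exists_isRayleighMax (V : Submodule ℂ A.domain) [FiniteDimensional ℂ V]
    [Nontrivial V] : ∃ m : EReal, IsRayleighMax A L Γ c l V m := by
  have : ProperSpace V := FiniteDimensional.proper ℂ V
  have hunit : ∀ v : V, v ≠ 0 → ((‖v‖⁻¹ : ℝ) : ℂ) • v ∈ Metric.sphere (0 : V) 1 := by
    intro v hv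
    rw [mem_sphere_zero_iff_norm, norm_smul, Complex.norm_real, norm_inv, norm_norm,
      inv_mul_cancel₀ (norm_ne_zero_iff.2 hv)]
  have hne0 : ∀ v ∈ Metric.sphere (0 : V) 1, (v : A.domain) ≠ 0 := by
    intro v hv h
    have : v = 0 := Subtype.ext h
    rw [this] at hv
    simp at hv
  obtain ⟨v, hv⟩ := exists_ne (0 : V)
  have husc : UpperSemicontinuousOn (fun u : V => rayleigh A L Γ c l u) (Metric.sphere 0 1) := by
    intro u hu y hy
    by_cases hyc : cExt L c l < y
    · exact Filter.Eventually.of_forall fun w =>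
        (cExt_le_rayleigh (A := A) (Γ := Γ) hc hl w).2.trans_lt hyc
    · obtain ⟨t, ht, h1, h2⟩ := exists_mem_interval_btwn
        (cExt_le_rayleigh (A := A) (Γ := Γ) hc hl (u : A.domain)).1 (not_lt.1 hyc) hy
      have h3 := (rayleigh_lt_iff hΓ hc hl (hne0 u hu) ht).1 h1
      rw [schurForm_eq] at h3
      have h4 : ∀ᶠ w : V in nhds u, partialForm A Γ c (Finset.Icc 1 L) w t < 0 :=
        (continuous_partialForm_restrict A Γ c (Finset.Icc 1 L) t V).continuousAt.eventually_lt
          continuousAt_const h3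
      filter_upwards [nhdsWithin_le_nhds h4, self_mem_nhdsWithin] with w hw hw1
      rw [← schurForm_eq] at hw
      exact ((rayleigh_lt_iff hΓ hc hl (hne0 w hw1) ht).2 hw).trans h2
  obtain ⟨w, hw, hmax⟩ := husc.exists_isMaxOn ⟨_, hunit v hv⟩ (isCompact_sphere (0 : V) 1)
  refine ⟨rayleigh A L Γ c l w, ⟨w, w.2, hne0 w hw, rfl⟩, ?_⟩
  rintro _ ⟨u, hu, hu0, rfl⟩
  have hu0' : (⟨u, hu⟩ : V) ≠ 0 := fun h => hu0 (congrArg Subtype.val h)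
  have h1 : rayleigh A L Γ c l (((‖(⟨u, hu⟩ : V)‖⁻¹ : ℝ) : ℂ) • u) ≤ rayleigh A L Γ c l w :=
    hmax (hunit ⟨u, hu⟩ hu0')
  rwa [rayleigh_smul_eq hΓ hc hl (inv_ne_zero (norm_ne_zero_iff.2 hu0')) hu0] at h1

variable [CompleteSpace H] (hA : IsSemiboundedDiscrete A)
include hA

/-- The hypothesis on `t₀` says that `nonposCount` first reaches `k` there. If the maximum of `p_l`
on `V` were below `t₀`, then `S(t)` would be negative on `V` for some earlier `t`, giving `k ≤
nonposCount` at `t`. Equality is attained on a `k`-dimensional subspace where `S(t₀)` is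
non-positive. -/
theorem min_max_principle {k : ℕ} (hk : 1 ≤ k) {t₀ : ℝ} (ht₀ : t₀ ∈ interval L c l)
    (h : ∀ t ∈ interval L c l, t₀ ≤ t ↔ k ≤ nonposCount A L Γ c t) :
    (∀ V : Submodule ℂ A.domain, Module.finrank ℂ V = k →
      ∃ m : EReal, IsRayleighMax A L Γ c l V m) ∧
    IsLeast {m : EReal | ∃ V : Submodule ℂ A.domain, Module.finrank ℂ V = k ∧
      IsRayleighMax A L Γ c l V m} (t₀ : EReal) := by
  have hmax : ∀ V : Submodule ℂ A.domain, Module.finrank ℂ V = k →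
      ∃ m : EReal, IsRayleighMax A L Γ c l V m := by
    intro V hV
    -- Since `finrank` is `0` for infinite-dimensional spaces, `1 ≤ k` is what makes `V`
    -- finite-dimensional as well as non-zero.
    have : FiniteDimensional ℂ V := Module.finite_of_finrank_pos (by omega)
    have : Nontrivial V := Module.nontrivial_of_finrank_pos (R := ℂ) (by omega)
    exact exists_isRayleighMax hΓ hc hl V
  have hlow : ∀ V : Submodule ℂ A.domain, Module.finrank ℂ V = k →
      ∀ m, IsRayleighMax A L Γ c l V m → (t₀ : EReal) ≤ m := by
    intro V hV m hm
    by_contra! hlt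
    obtain ⟨v, -, -, rfl⟩ := hm.1
    obtain ⟨t, ht, h1, h2⟩ := exists_mem_interval_btwn
      (cExt_le_rayleigh (A := A) (Γ := Γ) hc hl v).1 ht₀.2.le hlt
    have h3 : k ≤ negCount A L Γ c t := by
      rw [← hV]
      exact finrank_le_negCount hA hΓ t V fun u hu hu0 =>
        (rayleigh_lt_iff hΓ hc hl hu0 ht).1 ((hm.2 ⟨u, hu, hu0, rfl⟩).trans_lt h1)
    have h4 := (h t ht).2 (h3.trans (by rw [nonposCount_eq hA hΓ]; exact Nat.le_add_right _ _))
    exact h2.not_ge (EReal.coe_le_coe_iff.2 h4)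
  refine ⟨hmax, ?_, fun m ⟨V, hV, hm⟩ => hlow V hV m hm⟩
  obtain ⟨V, -, h2, h3⟩ := exists_submodule_schurForm_nonpos hA hΓ (c := c) t₀
  obtain ⟨V', hle, -, hV'⟩ := exists_submodule_finrank_eq V (h2 ▸ (h t₀ ht₀).1 le_rfl)
  obtain ⟨m, hm⟩ := hmax V' hV'
  have h4 := hlow V' hV' m hm
  obtain ⟨u, hu, hu0, rfl⟩ := hm.1
  have h5 := (rayleigh_le_iff hΓ hc hl hu0 ht₀).2 (h3 u (hle hu))
  exact ⟨V', hV', h4.antisymm h5 ▸ hm⟩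

end MinMax

end RationalPencil

namespace RationalPencil

variable {H : Type*} [NormedAddCommGroup H] [InnerProductSpace ℂ H]

/-! ### Estimates for the index shifts -/

theorem eventually_mem_interval {L : ℕ} {c : ℕ → ℝ} (hc : StrictMonoOn c (Set.Icc 1 L)) {l : ℕ}
    (hl : l ∈ Finset.Icc 2 (L + 1)) :
    ∀ᶠ t in nhdsWithin (c (l - 1)) (Set.Ioi (c (l - 1))), t ∈ interval L c l := by
  rw [Finset.mem_Icc] at hl
  have h1 := cExt_lt hc (l := l) (Finset.mem_Icc.2 ⟨by omega, hl.2⟩)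
  have h2 : cExt L c (l - 1) = (c (l - 1) : EReal) := by
    rw [cExt, if_neg (by omega), if_pos (by omega)]
  rw [h2] at h1
  have h3 : ∀ᶠ t in nhds (c (l - 1)), ((t : ℝ) : EReal) < cExt L c l :=
    (isOpen_lt continuous_coe_real_ereal continuous_const).mem_nhds h1
  filter_upwards [nhdsWithin_le_nhds h3, self_mem_nhdsWithin] with t h4 h5
  exact ⟨by rw [h2]; exact EReal.coe_lt_coe_iff.2 h5, h4⟩

/-- A non-negative bounded operator with closed range is bounded below on the complement of its
kernel. -/
theorem exists_form_ge_of_isClosed_range [CompleteSpace H] {G : H →L[ℂ] H} (hG : G.IsPositive)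
    (hcl : IsClosed (Set.range G)) :
    ∃ γ > 0, ∀ y ∈ (LinearMap.ker (G : H →ₗ[ℂ] H))ᗮ, γ * ‖y‖ ^ 2 ≤ (inner ℂ y (G y)).re := by
  set K := (LinearMap.ker (G : H →ₗ[ℂ] H)) with hK
  have hKcl : IsClosed (K : Set H) := G.isClosed_ker
  have : CompleteSpace K := hKcl.completeSpace_coe
  have hinj : Function.Injective (G ∘L Kᗮ.subtypeL) := by
    rw [injective_iff_map_eq_zero]
    intro y hy
    have h1 : (y : H) ∈ K := hy
    have h2 : inner ℂ (y : H) (y : H) = 0 := (Submodule.mem_orthogonal _ _).1 y.2 _ h1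
    exact Subtype.ext (inner_self_eq_zero.1 h2)
  have hrange : Set.range (G ∘L Kᗮ.subtypeL) = Set.range G := by
    ext z
    constructor
    · rintro ⟨y, rfl⟩
      exact ⟨y, rfl⟩
    · rintro ⟨x, rfl⟩
      refine ⟨⟨x - K.starProjection x, Submodule.sub_starProjection_mem_orthogonal x⟩, ?_⟩
      have h1 : G (K.starProjection x) = 0 := Submodule.starProjection_apply_mem K x
      change G (x - K.starProjection x) = G x
      rw [map_sub, h1, sub_zero]
  -- Injectivity and closed range bound `G` below in norm on the complement of its kernel.
  -- `norm_apply_sq_le` turns this into a bound on the quadratic form.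
  obtain ⟨κ, hκ⟩ := (G ∘L Kᗮ.subtypeL).antilipschitz_of_injective_of_isClosed_range hinj
    (by rw [hrange]; exact hcl)
  have hbd : ∀ y ∈ Kᗮ, ‖y‖ ≤ κ * ‖G y‖ := fun y hy =>
    (G ∘L Kᗮ.subtypeL).bound_of_antilipschitz hκ ⟨y, hy⟩
  refine ⟨((κ ^ 2 * ‖G‖ + 1 : ℝ))⁻¹, by positivity, fun y hy => ?_⟩
  rw [inv_mul_le_iff₀ (by positivity)]
  have h1 := norm_apply_sq_le G (fun x y => hG.isSymmetric x y) (fun x => hG.re_inner_nonneg_right x) y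
  have h2 : ‖y‖ ^ 2 ≤ κ ^ 2 * ‖G y‖ ^ 2 := by
    rw [← mul_pow]
    exact pow_le_pow_left₀ (norm_nonneg _) (hbd y hy) 2
  have h3 : 0 ≤ (inner ℂ y (G y)).re := hG.re_inner_nonneg_right y
  have h4 : (κ : ℝ) ^ 2 * ‖G y‖ ^ 2 ≤ κ ^ 2 * (‖G‖ * (inner ℂ y (G y)).re) := by gcongr
  linarith

section Invariant

variable {T : H →ₗ.[ℂ] H}

theorem apply_mem_eigenSpan {I : Set ℝ} {u : T.domain} (hu : (u : H) ∈ eigenSpan T I) :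
    T u ∈ eigenSpan T I := by
  have h : eigenSpan T I ≤ ((eigenSpan T I).comap T.toFun).map T.domain.subtype := by
    refine iSup₂_le fun t ht v hv => ?_
    obtain ⟨h, hv'⟩ := mem_eigenspace.1 hv
    refine ⟨⟨v, h⟩, ?_, rfl⟩
    change T ⟨v, h⟩ ∈ eigenSpan T I
    rw [hv']
    exact Submodule.smul_mem _ _ (eigenspace_le_eigenSpan T ht hv)
  obtain ⟨w, hw, hwu⟩ := h hu
  have : w = u := Subtype.ext hwu
  exact this ▸ hw

/-- The form splits orthogonally along the span of the eigenvectors for eigenvalues at most `μ`;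
on the complement it is strictly above `μ`. -/
theorem IsSemiboundedDiscrete.exists_form_ge_split [CompleteSpace H]
    (hT : IsSemiboundedDiscrete T) (μ : ℝ) : ∃ a : ℝ, ∃ δ > 0, ∀ s ≤ μ + δ, ∀ u : T.domain,
      (a - s) * ‖(spectralSubspace T (Set.Iic μ)).starProjection u‖ ^ 2 ≤
        form T u - s * ‖(u : H)‖ ^ 2 := by
  obtain ⟨a, ha⟩ := hT.below
  obtain ⟨δ, hδ, hgap⟩ := hT.exists_gap μ
  refine ⟨a, δ, hδ, fun s hs u => ?_⟩
  set W := spectralSubspace T (Set.Iic μ) with hW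
  have hWe : W = eigenSpan T (Set.Iic μ) := spectralSubspace_eq_eigenSpan hT le_rfl
  have hp : W.starProjection u ∈ T.domain :=
    hT.spectralSubspace_Iic_le_domain μ (Submodule.starProjection_apply_mem W _)
  set p : T.domain := ⟨W.starProjection u, hp⟩ with hpdef
  have hpW : (p : H) ∈ W := Submodule.starProjection_apply_mem W _
  have hv : ((u - p : T.domain) : H) ∈ Wᗮ := Submodule.sub_starProjection_mem_orthogonal (u : H)
  set v := u - p with hvdef
  have hu : u = p + v := by rw [hvdef]; abel
  -- `W` is invariant under `T`, so the cross terms of the form between `p` and `v` vanish. The part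
  -- `p` is bounded below by `a`, and `v` by the gap.
  have hTp : T p ∈ W := by
    rw [hWe] at hpW ⊢
    exact apply_mem_eigenSpan hpW
  have h1 : inner ℂ (T p) (v : H) = 0 := (Submodule.mem_orthogonal _ _).1 hv _ hTp
  have h2 : inner ℂ (p : H) (T v) = 0 := by rw [← hT.symm]; exact h1
  have h3 : inner ℂ (v : H) (T p) = 0 := inner_eq_zero_symm.1 h1
  have h4 : inner ℂ (p : H) (v : H) = 0 := (Submodule.mem_orthogonal _ _).1 hv _ hpW
  have hform : form T u = form T p + form T v := by
    rw [hu, form, T.map_add, Submodule.coe_add, inner_add_left, inner_add_right, inner_add_right,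
      h2, h3, form, form]
    simp
  have hnorm : ‖(u : H)‖ ^ 2 = ‖(p : H)‖ ^ 2 + ‖(v : H)‖ ^ 2 := by
    rw [hu, Submodule.coe_add, sq, sq, sq]
    exact norm_add_sq_eq_norm_sq_add_norm_sq_of_inner_eq_zero _ _ h4
  change (a - s) * ‖(p : H)‖ ^ 2 ≤ _
  rw [hform, hnorm]
  have h5 := ha p
  have h6 := hgap v hv
  have h7 : 0 ≤ ‖(v : H)‖ ^ 2 := by positivity
  nlinarith

end Invariant

variable {A : H →ₗ.[ℂ] H} {L : ℕ} {Γ : ℕ → H →L[ℂ] H} {c : ℕ → ℝ}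
  [CompleteSpace H] (hA : IsSemiboundedDiscrete A)
  (hΓ : ∀ l ∈ Finset.Icc 1 L, (Γ l).IsPositive) (hc : StrictMonoOn c (Set.Icc 1 L))

section
include hA hΓ

theorem indexShift_one_eq_zero (hL : 1 ≤ L) (hc : StrictMonoOn c (Set.Icc 1 L)) :
    indexShift A L Γ c 1 = 0 := by
  obtain ⟨a, ha⟩ := hA.below
  set B := ∑ j ∈ Finset.Icc 1 L, ‖Γ j‖ with hB
  -- The first bound makes every `(c_j - t)⁻¹ ≤ 1`. The second makes `a - t - B ≥ 0`, so the form
  -- has no negative vectors.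
  set t := min (c 1 - 1) (a - B) with ht
  have h1 : t ≤ c 1 - 1 := min_le_left _ _
  have h2 : t ≤ a - B := min_le_right _ _
  have htI : t ∈ interval L c 1 := by
    refine ⟨by simp [cExt], ?_⟩
    rw [cExt, if_neg one_ne_zero, if_pos hL, EReal.coe_lt_coe_iff]
    linarith
  refine Nat.le_zero.1 ((indexShift_le htI).trans ?_)
  obtain ⟨V, -, h3, h4⟩ := exists_submodule_schurForm_neg hA hΓ (c := c) t
  rw [← h3]
  have : V = ⊥ := by
    rw [Submodule.eq_bot_iff]
    intro u hu
    by_contra hne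
    have h5 := h4 u hu hne
    rw [schurForm_eq, partialForm] at h5
    have h6 : ∑ j ∈ Finset.Icc 1 L, (c j - t)⁻¹ * (inner ℂ (u : H) (Γ j u)).re ≤
        B * ‖(u : H)‖ ^ 2 := by
      rw [hB, Finset.sum_mul]
      refine Finset.sum_le_sum fun j hj => ?_
      have h7 : c 1 ≤ c j := by
        rw [Finset.mem_Icc] at hj
        exact hc.monotoneOn ⟨le_rfl, hL⟩ ⟨hj.1, hj.2⟩ hj.1
      refine (mul_le_of_le_one_left ((hΓ j hj).re_inner_nonneg_right _)
        (inv_le_one_of_one_le₀ (by linarith))).trans (abs_le.1 (re_inner_bounds _ _)).2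
    have h8 := ha u
    have h9 : 0 ≤ ‖(u : H)‖ ^ 2 := by positivity
    nlinarith
  rw [this, finrank_bot]

include hc

/-- Just to the right of `c_{l-1}`, dropping the poles at or below `c_{l-1}` lowers the form. The
remaining one is continuous up to `c_{l-1}`, and `exists_stable` absorbs the difference. -/
theorem indexShift_le_numLE_shiftOp {l : ℕ} (hl : l ∈ Finset.Icc 2 (L + 1)) :
    (indexShift A L Γ c l : ℕ∞) ≤ eigCount (shiftOp A L Γ c l) (c (l - 1)) := by
  have hl2 := Finset.mem_Icc.1 hl
  have hl1 : l ∈ Finset.Icc 1 (L + 1) := Finset.mem_Icc.2 ⟨by omega, hl2.2⟩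
  have hsub : Finset.Icc l L ⊆ Finset.Icc 1 L := Finset.Icc_subset_Icc_left (by omega)
  have hT : IsSemiboundedDiscrete (shiftOp A L Γ c l) := by
    refine isSemiboundedDiscrete_vadd hA _ fun x y => ?_
    have h : ∀ j ∈ Finset.Icc l L, inner ℂ (Γ j x) y = inner ℂ x (Γ j y) :=
      fun j hj => (hΓ j (hsub hj)).isSymmetric x y
    simp only [neg_apply, smul_apply, sum_apply, inner_neg_left,
      inner_neg_right, inner_smul_left, inner_smul_right, sum_inner, inner_sum, map_inv₀, map_sub,
      Complex.conj_ofReal]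
    rw [Finset.sum_congr rfl fun l hl => by rw [h l hl]]
  rw [hT.eigCount_eq]
  obtain ⟨ε, hε, hV⟩ := hT.exists_stable (c (l - 1))
  have hclose := partialForm_close A Γ c (Finset.Icc l L) (a := c (l - 1)) (fun j hj => by
    rw [Finset.mem_Icc] at hj
    exact (hc ⟨by omega, by omega⟩ ⟨by omega, hj.2⟩ (by omega)).ne) hε
  obtain ⟨t, ht, htI⟩ := ((hclose.filter_mono nhdsWithin_le_nhds).and
    (eventually_mem_interval hc hl)).exists
  obtain ⟨V, -, h3, h4⟩ := exists_submodule_schurForm_neg hA hΓ (c := c) t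
  have key : ∀ u : A.domain, u ∈ V → u ≠ 0 →
      form (shiftOp A L Γ c l) u < (c (l - 1) + ε) * ‖(u : H)‖ ^ 2 := by
    intro u hu hu0
    have h6 := h4 u hu hu0
    rw [schurForm_eq] at h6
    have h7 := partialForm_subset (A := A) hsub
      (fun j hj u => (hΓ j hj).re_inner_nonneg_right u) (t := t) (fun j hj hj' => by
        refine lt_of_mem_interval hc hl1 htI hj ?_
        rw [Finset.mem_Icc] at hj hj'
        omega) u
    have h8 := (abs_le.1 (ht u)).1
    have h9 := form_shiftOp A L Γ c l u
    linarith
  exact_mod_cast (indexShift_le htI).trans (h3 ▸ (hV V key).2)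

/-- If `Γ_{l-1}` has closed range, the index shift is bounded by the rank of any linear map whose
kernel consists of vectors `u` such that `Q u` is annihilated by `P` and by the remaining `Γ_j`. -/
theorem indexShift_le_dimE_range {F : Type*} [AddCommGroup F] [Module ℂ F] {l : ℕ}
    (hl : l ∈ Finset.Icc 2 (L + 1)) (hcl : IsClosed (Set.range (Γ (l - 1)))) (f : A.domain →ₗ[ℂ] F)
    (hf : ∀ u : A.domain, f u = 0 → projP A c (l - 1) (projQ Γ (l - 1) u) = 0 ∧
      ∀ j ∈ Finset.Icc l L, Γ j (projQ Γ (l - 1) u) = 0) :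
    (indexShift A L Γ c l : ℕ∞) ≤ dimE (LinearMap.range f) := by
  have hl2 := Finset.mem_Icc.1 hl
  obtain ⟨k, rfl⟩ : ∃ k, l = k + 1 := ⟨l - 1, by omega⟩
  simp only [Nat.add_sub_cancel] at hcl hf ⊢
  have hl1 : k + 1 ∈ Finset.Icc 1 (L + 1) := Finset.mem_Icc.2 ⟨by omega, hl2.2⟩
  have hk1 : k ∈ Finset.Icc 1 L := Finset.mem_Icc.2 ⟨by omega, by omega⟩
  have hsub : Finset.Icc k L ⊆ Finset.Icc 1 L := Finset.Icc_subset_Icc_left (by omega)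
  obtain ⟨γ, hγ, hΓγ⟩ := exists_form_ge_of_isClosed_range (hΓ k hk1) hcl
  obtain ⟨a, δ, hδ, hsplit⟩ := hA.exists_form_ge_split (c k)
  -- For vectors with `f u = 0`, the form without its `Γ_k` term will be at least `-ω(s)‖y‖²`, where
  -- `y` is the component of `u` orthogonal to `ker Γ_k`.
  set ω : ℝ → ℝ := fun s => |a - s| + ∑ j ∈ Finset.Icc (k + 1) L, |(c j - s)⁻¹| * ‖Γ j‖ with hω
  have hcont : ContinuousAt ω (c k) := by
    refine ContinuousAt.add (by fun_prop) ?_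
    refine tendsto_finsetSum _ fun j hj => ?_
    refine (ContinuousAt.abs (ContinuousAt.inv₀ (by fun_prop) ?_)).mul continuousAt_const
    rw [Finset.mem_Icc] at hj hk1
    exact sub_ne_zero.2 (hc ⟨by omega, by omega⟩ ⟨by omega, hj.2⟩ (by omega)).ne'
  have hev1 : ∀ᶠ s in nhdsWithin (c k) (Set.Ioi (c k)), ω s < ω (c k) + 1 :=
    (hcont.eventually_lt continuousAt_const (by linarith)).filter_mono nhdsWithin_le_nhds
  have hev2 : ∀ᶠ s in nhdsWithin (c k) (Set.Ioi (c k)), s < c k + δ :=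
    (continuousAt_id.eventually_lt continuousAt_const (by simpa using hδ)).filter_mono
      nhdsWithin_le_nhds
  have hω0 : 0 ≤ ω (c k) := by positivity
  -- This closeness gives `γ/(s - c_k) ≥ ω(c_k) + 1`, which dominates `ω(s)` and contradicts
  -- negativity of the form.
  have hev3 : ∀ᶠ s in nhdsWithin (c k) (Set.Ioi (c k)), s < c k + γ / (ω (c k) + 1) :=
    (continuousAt_id.eventually_lt continuousAt_const (by
      have : 0 < γ / (ω (c k) + 1) := by positivity
      simpa using this)).filter_mono nhdsWithin_le_nhds
  have hev4 := eventually_mem_interval hc hl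
  simp only [Nat.add_sub_cancel] at hev4
  obtain ⟨s, ⟨⟨⟨⟨hs1, hs2⟩, hs3⟩, hs4⟩, hs5⟩⟩ := ((((hev1.and hev2).and hev3).and hev4).and
    (self_mem_nhdsWithin : Set.Ioi (c k) ∈ nhdsWithin (c k) (Set.Ioi (c k)))).exists
  obtain ⟨V, hVfd, h3, h4⟩ := exists_submodule_schurForm_neg hA hΓ (c := c) s
  refine le_trans ?_ (finrank_le_dimE_range V f fun u hu hfu => ?_)
  · rw [h3]
    exact_mod_cast indexShift_le hs4
  by_contra hne
  have hneg := h4 u hu hne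
  rw [schurForm_eq] at hneg
  have h7 := partialForm_subset (A := A) hsub
      (fun j hj u => (hΓ j hj).re_inner_nonneg_right u) (t := s) (fun j hj hj' => by
        refine lt_of_mem_interval hc hl1 hs4 hj ?_
        rw [Finset.mem_Icc] at hj hj'
        omega) u
  obtain ⟨hPx, hGx⟩ := hf u hfu
  set x := projQ Γ k (u : H) with hx
  set y := (u : H) - x with hy
  have huxy : (u : H) = x + y := by rw [hy]; abel
  have hyK : y ∈ (LinearMap.ker (Γ k : H →ₗ[ℂ] H))ᗮ :=
    Submodule.sub_starProjection_mem_orthogonal (u : H)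
  have hxk : Γ k x = 0 := Submodule.starProjection_apply_mem (LinearMap.ker (Γ k : H →ₗ[ℂ] H)) _
  -- The component `x = Q u` is annihilated by all `Γ_j` with `j ≥ k`, so these forms see only `y`.
  have hinner : ∀ j ∈ Finset.Icc k L,
      (inner ℂ (u : H) (Γ j u)).re = (inner ℂ y (Γ j y)).re := by
    intro j hj
    have h0 : Γ j x = 0 := by
      rcases (Finset.mem_Icc.1 hj).1.eq_or_lt with h | h
      · rw [← h]; exact hxk
      · exact hGx j (Finset.mem_Icc.2 ⟨h, (Finset.mem_Icc.1 hj).2⟩)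
    have h1 : Γ j u = Γ j y := by rw [huxy, map_add, h0, zero_add]
    have h2 : inner ℂ x (Γ j y) = 0 := by
      have := (hΓ j (hsub hj)).isSymmetric x y
      change inner ℂ (Γ j x) y = inner ℂ x (Γ j y) at this
      rw [← this, h0, inner_zero_left]
    rw [h1, huxy, inner_add_left, h2, zero_add]
  have hPu : ‖(spectralSubspace A (Set.Iic (c k))).starProjection (u : H)‖ ≤ ‖y‖ := by
    have : (spectralSubspace A (Set.Iic (c k))).starProjection (u : H) =
        (spectralSubspace A (Set.Iic (c k))).starProjection y := by
      rw [huxy, map_add]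
      have : (spectralSubspace A (Set.Iic (c k))).starProjection x = 0 := hPx
      rw [this, zero_add]
    rw [this]
    exact Submodule.norm_starProjection_apply_le _ _
  have hPu2 : ‖(spectralSubspace A (Set.Iic (c k))).starProjection (u : H)‖ ^ 2 ≤ ‖y‖ ^ 2 :=
    pow_le_pow_left₀ (norm_nonneg _) hPu 2
  have hAu := hsplit s hs2.le u
  have hA2 : -(|a - s| * ‖y‖ ^ 2) ≤ form A u - s * ‖(u : H)‖ ^ 2 := by
    refine le_trans ?_ hAu
    have h8 := neg_abs_le (a - s)
    have h9 := abs_nonneg (a - s)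
    have h10 : 0 ≤ ‖(spectralSubspace A (Set.Iic (c k))).starProjection (u : H)‖ ^ 2 := by
      positivity
    nlinarith
  have hsum : ∑ j ∈ Finset.Icc (k + 1) L, (c j - s)⁻¹ * (inner ℂ (u : H) (Γ j u)).re ≤
      (∑ j ∈ Finset.Icc (k + 1) L, |(c j - s)⁻¹| * ‖Γ j‖) * ‖y‖ ^ 2 := by
    rw [Finset.sum_mul]
    refine Finset.sum_le_sum fun j hj => ?_
    rw [hinner j (Finset.Icc_subset_Icc_left (by omega) hj), mul_assoc]
    refine (le_abs_self _).trans ?_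
    rw [abs_mul]
    exact mul_le_mul_of_nonneg_left (re_inner_bounds _ _) (abs_nonneg _)
  have hsplitsum : ∑ j ∈ Finset.Icc k L, (c j - s)⁻¹ * (inner ℂ (u : H) (Γ j u)).re =
      (c k - s)⁻¹ * (inner ℂ (u : H) (Γ k u)).re +
        ∑ j ∈ Finset.Icc (k + 1) L, (c j - s)⁻¹ * (inner ℂ (u : H) (Γ j u)).re := by
    have : Finset.Ioc k L = Finset.Icc (k + 1) L := by
      ext j
      simp only [Finset.mem_Ioc, Finset.mem_Icc, Nat.succ_le_iff]
    rw [← Finset.add_sum_Ioc_eq_sum_Icc (Finset.mem_Icc.1 hk1).2, this]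
  have hGk : (ω (c k) + 1) * ‖y‖ ^ 2 ≤ -((c k - s)⁻¹ * (inner ℂ (u : H) (Γ k u)).re) := by
    rw [hinner k (Finset.mem_Icc.2 ⟨le_rfl, (Finset.mem_Icc.1 hk1).2⟩)]
    have h8 := hΓγ y hyK
    have h9 : 0 < s - c k := by linarith
    have h10 : -(c k - s)⁻¹ = (s - c k)⁻¹ := by rw [← inv_neg, neg_sub]
    rw [← neg_mul, h10, ← div_eq_inv_mul, le_div_iff₀ h9]
    have h11 : (s - c k) * (ω (c k) + 1) ≤ γ := by
      rw [← le_div_iff₀ (by linarith)]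
      linarith
    have h12 : 0 ≤ ‖y‖ ^ 2 := by positivity
    nlinarith
  simp only [partialForm, hsplitsum] at h7 hneg
  have h13 : ω s * ‖y‖ ^ 2 ≤ (ω (c k) + 1) * ‖y‖ ^ 2 :=
    mul_le_mul_of_nonneg_right hs1.le (by positivity)
  rw [hω] at h13 hGk
  simp only [add_mul] at h13 hGk
  linarith

end

end RationalPencil

/-! ### Rank bounds for the index shifts and subspaces for infinite rank -/

namespace RationalPencil

variable {H : Type*} [NormedAddCommGroup H] [InnerProductSpace ℂ H]

theorem exists_submodule_finrank_eq_of_infinite {E : Type*} [AddCommGroup E] [Module ℂ E]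
    (V : Submodule ℂ E) (hV : ¬ FiniteDimensional ℂ V) (k : ℕ) :
    ∃ V' ≤ V, FiniteDimensional ℂ V' ∧ Module.finrank ℂ V' = k := by
  have h1 : (k : Cardinal) ≤ Module.rank ℂ V := by
    refine Cardinal.natCast_le_aleph0.trans (not_lt.1 fun h => hV ?_)
    exact Module.rank_lt_aleph0_iff.1 h
  obtain ⟨f, hf⟩ := Module.le_rank_iff.1 h1
  have hf' : LinearIndependent ℂ (fun i => (f i : E)) := hf.map' V.subtype (Submodule.ker_subtype V)
  refine ⟨Submodule.span ℂ (Set.range fun i => (f i : E)), ?_, ?_, ?_⟩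
  · rw [Submodule.span_le]
    rintro _ ⟨i, rfl⟩
    exact (f i).2
  · exact FiniteDimensional.span_of_finite ℂ (Set.finite_range _)
  · rw [finrank_span_eq_card hf', Fintype.card_fin]

/-- A linear map of infinite rank is injective on subspaces of any finite dimension. -/
theorem exists_submodule_injOn {E F : Type*} [AddCommGroup E] [Module ℂ E] [AddCommGroup F]
    [Module ℂ F] (f : E →ₗ[ℂ] F) (hf : ¬ FiniteDimensional ℂ (LinearMap.range f)) (k : ℕ) :
    ∃ V : Submodule ℂ E, FiniteDimensional ℂ V ∧ Module.finrank ℂ V = k ∧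
      ∀ u ∈ V, f u = 0 → u = 0 := by
  obtain ⟨q, hq⟩ := Submodule.exists_isCompl (LinearMap.ker f)
  have hqinf : ¬ FiniteDimensional ℂ q := fun h =>
    hf (Module.Finite.equiv ((Submodule.quotientEquivOfIsCompl _ q hq).symm.trans
      f.quotKerEquivRange))
  obtain ⟨V, hVq, h1, h2⟩ := exists_submodule_finrank_eq_of_infinite q hqinf k
  refine ⟨V, h1, h2, fun u hu hfu => ?_⟩
  have : u ∈ LinearMap.ker f ⊓ q := ⟨hfu, hVq hu⟩
  rwa [hq.inf_eq_bot, Submodule.mem_bot] at this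

/-- If a bounded operator has finite rank on a dense subspace, it has finite rank. -/
theorem finiteDimensional_range_of_dense {D : Submodule ℂ H} (hD : Dense (D : Set H))
    (G : H →L[ℂ] H) (h : FiniteDimensional ℂ (LinearMap.range ((G : H →ₗ[ℂ] H) ∘ₗ D.subtype))) :
    FiniteDimensional ℂ (LinearMap.range (G : H →ₗ[ℂ] H)) := by
  refine Submodule.finiteDimensional_of_le
    (S₂ := LinearMap.range ((G : H →ₗ[ℂ] H) ∘ₗ D.subtype)) ?_
  rintro _ ⟨x, rfl⟩
  have hcl := Submodule.closed_of_finiteDimensional (LinearMap.range ((G : H →ₗ[ℂ] H) ∘ₗ D.subtype))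
  have hpre : IsClosed (G ⁻¹' (LinearMap.range ((G : H →ₗ[ℂ] H) ∘ₗ D.subtype) : Set H)) :=
    hcl.preimage G.continuous
  have hsub : (D : Set H) ⊆ G ⁻¹' (LinearMap.range ((G : H →ₗ[ℂ] H) ∘ₗ D.subtype) : Set H) :=
    fun y hy => ⟨⟨y, hy⟩, rfl⟩
  exact hpre.closure_subset_iff.2 hsub (hD x)

theorem finiteDimensional_topologicalClosure_iff (V : Submodule ℂ H) :
    FiniteDimensional ℂ V.topologicalClosure ↔ FiniteDimensional ℂ V := by
  constructor
  · intro h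
    exact Submodule.finiteDimensional_of_le V.le_topologicalClosure
  · intro h
    rwa [(Submodule.closed_of_finiteDimensional V).submodule_topologicalClosure_eq]

/-- Even `A` is bounded on a finite-dimensional subspace of its domain, so a term growing without
bound can outweigh everything else there. -/
theorem exists_partialForm_le (A : H →ₗ.[ℂ] H) (Γ : ℕ → H →L[ℂ] H) (c : ℕ → ℝ) (s : Finset ℕ)
    (t : ℝ) (V : Submodule ℂ A.domain) [FiniteDimensional ℂ V] :
    ∃ C : ℝ, ∀ u ∈ V, partialForm A Γ c s u t ≤ C * ‖(u : H)‖ ^ 2 := by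
  set F : V →L[ℂ] H := LinearMap.toContinuousLinearMap (A.toFun ∘ₗ V.subtype) with hF
  refine ⟨‖F‖ + |t| + ∑ j ∈ s, |(c j - t)⁻¹| * ‖Γ j‖, fun u hu => ?_⟩
  have h1 : form A u ≤ ‖F‖ * ‖(u : H)‖ ^ 2 := by
    have h2 : ‖A u‖ ≤ ‖F‖ * ‖(u : H)‖ := F.le_opNorm ⟨u, hu⟩
    calc form A u ≤ ‖inner ℂ (u : H) (A u)‖ := Complex.re_le_norm _
      _ ≤ ‖(u : H)‖ * ‖A u‖ := norm_inner_le_norm _ _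
      _ ≤ ‖(u : H)‖ * (‖F‖ * ‖(u : H)‖) := by gcongr
      _ = _ := by ring
  have h3 : -(t * ‖(u : H)‖ ^ 2) ≤ |t| * ‖(u : H)‖ ^ 2 := by
    rw [← neg_mul]
    exact mul_le_mul_of_nonneg_right (neg_le_abs t) (by positivity)
  have h4 : -∑ j ∈ s, (c j - t)⁻¹ * (inner ℂ (u : H) (Γ j u)).re ≤
      (∑ j ∈ s, |(c j - t)⁻¹| * ‖Γ j‖) * ‖(u : H)‖ ^ 2 := by
    rw [Finset.sum_mul, ← Finset.sum_neg_distrib]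
    refine Finset.sum_le_sum fun j _ => ?_
    refine (neg_le_abs _).trans ?_
    rw [abs_mul, mul_assoc]
    exact mul_le_mul_of_nonneg_left (re_inner_bounds _ _) (abs_nonneg _)
  rw [partialForm, add_mul, add_mul]
  linarith

variable {A : H →ₗ.[ℂ] H} {L : ℕ} {Γ : ℕ → H →L[ℂ] H} {c : ℕ → ℝ}
  [CompleteSpace H] (hA : IsSemiboundedDiscrete A)
  (hΓ : ∀ l ∈ Finset.Icc 1 L, (Γ l).IsPositive) (hc : StrictMonoOn c (Set.Icc 1 L))

section
include hΓ

omit [CompleteSpace H] in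
theorem eq_zero_of_re_inner_eq_zero {j : ℕ} (hj : j ∈ Finset.Icc 1 L) {x : H}
    (hx : (inner ℂ x (Γ j x)).re = 0) : Γ j x = 0 := by
  have := norm_apply_sq_le (Γ j) (fun x y => (hΓ j hj).isSymmetric x y)
    (fun x => (hΓ j hj).re_inner_nonneg_right x) x
  rw [hx, mul_zero] at this
  simpa using this

include hA hc

/-- If the compressed operator annihilates `u`, pair the result with `x = Q u`. On the range of `P`
the form of `A - t` is at most `(c_{l-1} - t)‖Px‖²`, and the `Γ_j` terms are non-positive. A zero
sum forces `P x = 0` and `Γ_j x = 0`, as `indexShift_le_dimE_range` requires. -/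
theorem indexShift_le_rank_compressedOp {l : ℕ} (hl : l ∈ Finset.Icc 2 (L + 1))
    (hcl : IsClosed (Set.range (Γ (l - 1)))) {t : ℝ} (ht : t ∈ interval L c l) :
    (indexShift A L Γ c l : ℕ∞) ≤
      dimE (LinearMap.range (compressedOp A L Γ c l t).toFun) := by
  have hl2 := Finset.mem_Icc.1 hl
  have hl1 : l ∈ Finset.Icc 1 (L + 1) := Finset.mem_Icc.2 ⟨by omega, hl2.2⟩
  have hsub : Finset.Icc l L ⊆ Finset.Icc 1 L := Finset.Icc_subset_Icc_left (by omega)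
  have hPdom : ∀ x : H, projP A c (l - 1) x ∈ A.domain := fun x =>
    hA.spectralSubspace_Iic_le_domain _ (Submodule.starProjection_apply_mem _ x)
  -- The range of `P` lies in `dom A`, so the natural domain is the whole space.
  have hdom : ∀ x : H, x ∈ (compressedOp A L Γ c l t).domain := fun x =>
    hPdom (projQ Γ (l - 1) x)
  have happly : ∀ x : H, (compressedOp A L Γ c l t) ⟨x, hdom x⟩ = projQ Γ (l - 1)
      ((-(∑ j ∈ Finset.Icc l L, ((c j : ℂ) - (t : ℂ))⁻¹ • Γ j : H →L[ℂ] H) : H →L[ℂ] H)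
          (projQ Γ (l - 1) x) +
        projP A c (l - 1) (-((t : ℂ) • projP A c (l - 1) (projQ Γ (l - 1) x)) +
          A ⟨projP A c (l - 1) (projQ Γ (l - 1) x), hPdom _⟩)) := fun x => rfl
  set f : A.domain →ₗ[ℂ] H := (compressedOp A L Γ c l t).toFun ∘ₗ
    A.domain.subtype.codRestrict _ (fun x => hdom x) with hf
  refine (indexShift_le_dimE_range hA hΓ hc hl hcl f fun u hu => ?_).trans
    (dimE_mono (LinearMap.range_comp_le_range _ _))
  have hu' : (compressedOp A L Γ c l t) ⟨(u : H), hdom u⟩ = 0 := hu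
  rw [happly] at hu'
  set x := projQ Γ (l - 1) (u : H) with hx
  obtain ⟨p, hp⟩ : ∃ p : A.domain, p = ⟨projP A c (l - 1) x, hPdom x⟩ := ⟨_, rfl⟩
  have hpx : projP A c (l - 1) x = p := by rw [hp]
  have hu'' : projQ Γ (l - 1)
      ((-(∑ j ∈ Finset.Icc l L, ((c j : ℂ) - (t : ℂ))⁻¹ • Γ j : H →L[ℂ] H) : H →L[ℂ] H) x +
        projP A c (l - 1) (-((t : ℂ) • (p : H)) + A p)) = 0 := by
    rw [hp]; exact hu'
  have hQx : projQ Γ (l - 1) x = x :=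
    Submodule.starProjection_eq_self_iff.2 (Submodule.starProjection_apply_mem _ _)
  have hQs : ∀ y z : H, inner ℂ (projQ Γ (l - 1) y) z = inner ℂ y (projQ Γ (l - 1) z) :=
    fun y z => Submodule.inner_starProjection_left_eq_right _ y z
  have hPs : ∀ y z : H, inner ℂ (projP A c (l - 1) y) z = inner ℂ y (projP A c (l - 1) z) :=
    fun y z => Submodule.inner_starProjection_left_eq_right _ y z
  have h0 := congrArg (fun z => (inner ℂ x z).re) hu''
  simp only [inner_zero_right, Complex.zero_re] at h0
  have h2 : (inner ℂ (p : H) ((t : ℂ) • (p : H))).re = t * ‖(p : H)‖ ^ 2 := by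
    rw [inner_smul_right, inner_self_eq_norm_sq_to_K, Complex.re_ofReal_mul]
    norm_cast
  have h1 := re_inner_sum_smul Γ (Finset.Icc l L) (fun j => (c j - t)⁻¹) x
  simp only [Complex.ofReal_sub, Complex.ofReal_inv] at h1
  rw [← hQs, hQx, inner_add_right, ← hPs, hpx, inner_add_right, neg_apply, inner_neg_right,
    inner_neg_right, Complex.add_re, Complex.add_re, Complex.neg_re, Complex.neg_re, h1, h2] at h0
  have h3 : (inner ℂ (p : H) (A p)).re ≤ c (l - 1) * ‖(p : H)‖ ^ 2 := by
    refine form_le_of_mem_eigenSpan hA.symm (u := p) ?_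
    rw [← spectralSubspace_eq_eigenSpan hA le_rfl, ← hpx]
    exact Submodule.starProjection_apply_mem _ _
  have h4 : c (l - 1) < t :=
    lt_of_mem_interval hc hl1 ht (Finset.mem_Icc.2 ⟨by omega, by omega⟩) (by omega)
  have h5 : ∀ j ∈ Finset.Icc l L, 0 ≤ (c j - t)⁻¹ * (inner ℂ x (Γ j x)).re := by
    intro j hj
    have := gt_of_mem_interval hc hl1 ht (hsub hj) (Finset.mem_Icc.1 hj).1
    exact mul_nonneg (inv_nonneg.2 (by linarith)) ((hΓ j (hsub hj)).re_inner_nonneg_right x)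
  have h6 := Finset.sum_nonneg h5
  have h7 : 0 ≤ ‖(p : H)‖ ^ 2 := by positivity
  have h8 : ‖(p : H)‖ ^ 2 = 0 := by nlinarith
  have h9 : ∑ j ∈ Finset.Icc l L, (c j - t)⁻¹ * (inner ℂ x (Γ j x)).re = 0 := by
    rw [h8] at h0 h3
    linarith
  refine ⟨hpx.trans (by simpa using h8), fun j hj => ?_⟩
  have h10 := (Finset.sum_eq_zero_iff_of_nonneg h5).1 h9 j hj
  have := gt_of_mem_interval hc hl1 ht (hsub hj) (Finset.mem_Icc.1 hj).1
  exact eq_zero_of_re_inner_eq_zero hΓ (hsub hj)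
    ((mul_eq_zero.1 h10).resolve_left (inv_ne_zero (by linarith)))

/-- No poles remain to the right, so the vanishing of `P Q u` is the only condition on the kernel.
-/
theorem indexShift_last_le_rank (hL : 1 ≤ L) (hcl : IsClosed (Set.range (Γ L))) :
    (indexShift A L Γ c (L + 1) : ℕ∞) ≤ dimE (LinearMap.range
      ((projP A c L ∘L projQ Γ L : H →L[ℂ] H) : H →ₗ[ℂ] H)) := by
  refine (indexShift_le_dimE_range hA hΓ hc (l := L + 1) (Finset.mem_Icc.2 ⟨by omega, le_rfl⟩) hcl
    (((projP A c L ∘L projQ Γ L : H →L[ℂ] H) : H →ₗ[ℂ] H) ∘ₗ A.domain.subtype)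
    fun u hu => ⟨hu, fun j hj => ?_⟩).trans (dimE_mono (LinearMap.range_comp_le_range _ _))
  rw [Finset.mem_Icc] at hj
  omega

end

omit [CompleteSpace H] in
theorem dimE_range_comp_le {F E : Submodule ℂ H} [F.HasOrthogonalProjection]
    [E.HasOrthogonalProjection] : dimE (LinearMap.range
      ((F.starProjection ∘L E.starProjection : H →L[ℂ] H) : H →ₗ[ℂ] H)) ≤ min (dimE F) (dimE E) := by
  refine le_min (dimE_mono ?_) ?_
  · rintro _ ⟨x, rfl⟩
    exact Submodule.starProjection_apply_mem _ _
  · refine le_trans (Cardinal.toENat.monotone' (LinearMap.rank_comp_le_right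
      (E.starProjection : H →ₗ[ℂ] H) (F.starProjection : H →ₗ[ℂ] H))) (dimE_mono ?_)
    rintro _ ⟨x, rfl⟩
    exact Submodule.starProjection_apply_mem _ _

/-! ### Infinitely many eigenvalues -/

section
include hA hΓ hc

/-- On a `k`-dimensional subspace the form is at most `C‖u‖²` at some `b`. It decreases at rate at
least one, hence is negative at `b + C + 1` or later. Density of `dom A` provides such subspaces for
every `k` when `H` is infinite-dimensional. -/
theorem negCount_unbounded_last_iff (hdense : Dense (A.domain : Set H)) :
    (∀ k : ℕ, ∃ t ∈ interval L c (L + 1), k ≤ negCount A L Γ c t) ↔ ¬ FiniteDimensional ℂ H := by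
  have hl : L + 1 ∈ Finset.Icc 1 (L + 1) := Finset.mem_Icc.2 ⟨by omega, le_rfl⟩
  constructor
  · intro h hfd
    obtain ⟨t, -, ht⟩ := h (Module.finrank ℂ H + 1)
    have := Submodule.finrank_le (spectralSubspace (schur A L Γ c (t : ℂ)) (Set.Iio 0))
    rw [negCount, numLT] at ht
    omega
  · intro hinf k
    have hdom : ¬ FiniteDimensional ℂ A.domain := by
      intro h
      have := Submodule.closed_of_finiteDimensional A.domain
      have htop : A.domain = ⊤ := by
        rw [← this.submodule_topologicalClosure_eq]
        exact Submodule.dense_iff_topologicalClosure_eq_top.1 hdense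
      rw [htop] at h
      exact hinf (Module.Finite.equiv (Submodule.topEquiv (R := ℂ) (M := H)))
    obtain ⟨V, -, hV, hVk⟩ := exists_submodule_finrank_eq_of_infinite (⊤ : Submodule ℂ A.domain)
      (fun h => hdom (Module.Finite.equiv (Submodule.topEquiv (R := ℂ) (M := A.domain)))) k
    obtain ⟨b, hb, -⟩ := exists_mem_interval_btwn le_rfl le_rfl (cExt_lt hc hl)
    obtain ⟨C, hC⟩ := exists_partialForm_le A Γ c (Finset.Icc 1 L) b V
    set t := max b (b + C + 1) with ht
    have h1 : b ≤ t := le_max_left _ _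
    have h2 : b + C + 1 ≤ t := le_max_right _ _
    have htI : t ∈ interval L c (L + 1) :=
      ⟨hb.1.trans_le (EReal.coe_le_coe_iff.2 h1), by simp [cExt]⟩
    refine ⟨t, htI, hVk ▸ finrank_le_negCount hA hΓ t V fun u hu hu0 => ?_⟩
    have h3 := schurForm_anti hΓ hc hl hb htI h1 u
    have h4 := hC u hu
    rw [← schurForm_eq] at h4
    have h5 := norm_sq_pos_of_ne_zero hu0
    nlinarith

/-- If `Γ_l` has finite rank, the part of a negative subspace inside `ker Γ_l` does not feel the
pole at `c_l`. There `A` is bounded above uniformly in `t`, so its dimension is bounded. If the rank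
is infinite, `Γ_l` is coercive on subspaces of any finite dimension and its term tends to `-∞` as `t
→ c_l`. -/
theorem negCount_unbounded_iff (hdense : Dense (A.domain : Set H)) {l : ℕ}
    (hlL : l ∈ Finset.Icc 1 L) : (∀ k : ℕ, ∃ t ∈ interval L c l, k ≤ negCount A L Γ c t) ↔
      ¬ FiniteDimensional ℂ (LinearMap.range (Γ l : H →ₗ[ℂ] H)) := by
  have hlm := Finset.mem_Icc.1 hlL
  have hl : l ∈ Finset.Icc 1 (L + 1) := Finset.mem_Icc.2 ⟨by omega, by omega⟩
  have hcl : cExt L c l = (c l : EReal) := by rw [cExt, if_neg (by omega), if_pos hlm.2]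
  have hsplit : ∀ (u : A.domain) (t : ℝ), schurForm A L Γ c u t =
      partialForm A Γ c ((Finset.Icc 1 L).erase l) u t -
        (c l - t)⁻¹ * (inner ℂ (u : H) (Γ l u)).re := by
    intro u t
    rw [schurForm_eq, partialForm, partialForm, ← Finset.add_sum_erase _ _ hlL]
    ring
  constructor
  · intro h hfd
    -- This bounds the terms with poles to the right of `c_l` for all `t < c_l`. The terms with
    -- poles to the left have the favourable sign.
    set B := ∑ j ∈ Finset.Icc (l + 1) L, (c j - c l)⁻¹ * ‖Γ j‖ with hB
    obtain ⟨t, ht, htk⟩ := h (Module.finrank ℂ (LinearMap.range (Γ l : H →ₗ[ℂ] H)) +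
      numLE A (c l + B) + 1)
    obtain ⟨V, hVfd, hVk, hV⟩ := exists_submodule_schurForm_neg hA hΓ (c := c) t
    set g : V →ₗ[ℂ] H := (Γ l : H →ₗ[ℂ] H) ∘ₗ A.domain.subtype ∘ₗ V.subtype with hg
    have h1 := g.finrank_range_add_finrank_ker
    have h2 : Module.finrank ℂ (LinearMap.range g) ≤
        Module.finrank ℂ (LinearMap.range (Γ l : H →ₗ[ℂ] H)) :=
      Submodule.finrank_mono (LinearMap.range_comp_le_range _ _)
    have h3 : Module.finrank ℂ (LinearMap.ker g) ≤ numLE A (c l + B) := by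
      rw [← Submodule.finrank_map_subtype_eq V (LinearMap.ker g)]
      refine (hA.finrank_le_numLE _ _ ?_).2
      rintro _ ⟨u, hu, rfl⟩
      have hgu : Γ l ((u : A.domain) : H) = 0 := hu
      by_cases hu0 : (u : A.domain) = 0
      · change form A (u : A.domain) ≤ _ * ‖((u : A.domain) : H)‖ ^ 2
        rw [hu0, form]
        simp
      have h4 := hV u u.2 hu0
      rw [schurForm_eq, partialForm] at h4
      have htl : t < c l := gt_of_mem_interval hc hl ht hlL le_rfl
      have h5 : ∑ j ∈ Finset.Icc 1 L,
          (c j - t)⁻¹ * (inner ℂ ((u : A.domain) : H) (Γ j (u : A.domain))).re ≤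
          B * ‖((u : A.domain) : H)‖ ^ 2 := by
        have hsub : Finset.Icc (l + 1) L ⊆ Finset.Icc 1 L :=
          Finset.Icc_subset_Icc_left (by omega)
        rw [← Finset.sum_sdiff hsub]
        have h6 : ∑ j ∈ Finset.Icc 1 L \ Finset.Icc (l + 1) L,
            (c j - t)⁻¹ * (inner ℂ ((u : A.domain) : H) (Γ j (u : A.domain))).re ≤ 0 := by
          refine Finset.sum_nonpos fun j hj => ?_
          rw [Finset.mem_sdiff, Finset.mem_Icc, Finset.mem_Icc] at hj
          rcases eq_or_ne j l with rfl | hne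
          · rw [hgu]; simp
          · have hj1 : j ∈ Finset.Icc 1 L := Finset.mem_Icc.2 hj.1
            have := lt_of_mem_interval hc hl ht hj1 (by omega)
            exact mul_nonpos_of_nonpos_of_nonneg (inv_nonpos.2 (by linarith))
              ((hΓ j hj1).re_inner_nonneg_right _)
        have h7 : ∑ j ∈ Finset.Icc (l + 1) L,
            (c j - t)⁻¹ * (inner ℂ ((u : A.domain) : H) (Γ j (u : A.domain))).re ≤
            B * ‖((u : A.domain) : H)‖ ^ 2 := by
          rw [hB, Finset.sum_mul]
          refine Finset.sum_le_sum fun j hj => ?_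
          have hjm := Finset.mem_Icc.1 hj
          have hlj : c l < c j := hc ⟨hlm.1, hlm.2⟩ ⟨by omega, hjm.2⟩ (by omega)
          rw [mul_assoc]
          exact mul_le_mul (inv_anti₀ (by linarith) (by linarith))
            (abs_le.1 (re_inner_bounds _ _)).2 ((hΓ j (hsub hj)).re_inner_nonneg_right _)
            (inv_nonneg.2 (by linarith))
        linarith
      have h8 : 0 ≤ ‖((u : A.domain) : H)‖ ^ 2 := by positivity
      change form A (u : A.domain) ≤ _ * ‖((u : A.domain) : H)‖ ^ 2
      nlinarith
    omega
  · intro hinf k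
    obtain ⟨V, hVfd, hVk, hV⟩ := exists_submodule_injOn
      ((Γ l : H →ₗ[ℂ] H) ∘ₗ A.domain.subtype)
      (fun h => hinf (finiteDimensional_range_of_dense hdense (Γ l) h)) k
    obtain ⟨b, hb, -⟩ := exists_mem_interval_btwn le_rfl le_rfl (cExt_lt hc hl)
    obtain ⟨C, hC⟩ := exists_partialForm_le A Γ c ((Finset.Icc 1 L).erase l) b V
    have hcont : Continuous fun u : V => ((u : A.domain) : H) :=
      continuous_subtype_val.comp continuous_subtype_val
    obtain ⟨γ, hγ, hγV⟩ := exists_pos_mul_norm_sq_le (V := V)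
      (fun u => (inner ℂ ((u : A.domain) : H) (Γ l (u : A.domain))).re)
      (Complex.continuous_re.comp (hcont.inner ((Γ l).continuous.comp hcont)))
      (fun r u => by
        simp only [Submodule.coe_smul, map_smul, inner_smul_left, inner_smul_right,
          Complex.conj_ofReal, Complex.re_ofReal_mul]
        ring)
      (fun u hu => lt_of_le_of_ne ((hΓ l hlL).re_inner_nonneg_right _) fun h0 =>
        hu (Subtype.ext (hV u u.2 (eq_zero_of_re_inner_eq_zero hΓ hlL h0.symm))))
    have hbl : b < c l := gt_of_mem_interval hc hl hb hlL le_rfl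
    -- `D` is positive and exceeds `C`. Within `γ/D` of the pole, `γ/(c_l - t) ≥ D`, so the pole
    -- term outweighs the rest.
    set D := |C| + 1 with hD
    set t := max b (c l - γ / D) with ht
    have hDpos : 0 < D := by positivity
    have h1 : b ≤ t := le_max_left _ _
    have h2 : c l - γ / D ≤ t := le_max_right _ _
    have h3 : t < c l := max_lt hbl (by have : 0 < γ / D := by positivity
                                        linarith)
    have htI : t ∈ interval L c l :=
      ⟨hb.1.trans_le (EReal.coe_le_coe_iff.2 h1), by rw [hcl]; exact EReal.coe_lt_coe_iff.2 h3⟩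
    refine ⟨t, htI, hVk ▸ finrank_le_negCount hA hΓ t V fun u hu hu0 => ?_⟩
    rw [hsplit]
    have h4 := partialForm_anti (A := A) (s := (Finset.Icc 1 L).erase l)
      (fun j hj u => (hΓ j (Finset.mem_of_mem_erase hj)).re_inner_nonneg_right u) h1
      (fun j hj => by
        have hj1 := Finset.mem_of_mem_erase hj
        rcases lt_or_ge j l with h | h
        · exact Or.inr (lt_of_mem_interval hc hl hb hj1 h)
        · exact Or.inl (gt_of_mem_interval hc hl htI hj1 h)) u
    have h5 := hC u hu
    have h6 : γ * ‖(u : H)‖ ^ 2 ≤ (inner ℂ (u : H) (Γ l u)).re := hγV ⟨u, hu⟩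
    have h7 := norm_sq_pos_of_ne_zero hu0
    have h8 : 0 < c l - t := by linarith
    have h9 : D ≤ (c l - t)⁻¹ * γ := by
      rw [← div_eq_inv_mul, le_div_iff₀ h8, mul_comm, ← le_div_iff₀ hDpos]
      linarith
    have h10 : (c l - t)⁻¹ * (γ * ‖(u : H)‖ ^ 2) ≤
        (c l - t)⁻¹ * (inner ℂ (u : H) (Γ l u)).re :=
      mul_le_mul_of_nonneg_left h6 (inv_nonneg.2 h8.le)
    have h11 : D * ‖(u : H)‖ ^ 2 ≤ (c l - t)⁻¹ * (γ * ‖(u : H)‖ ^ 2) := by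
      rw [← mul_assoc]
      exact mul_le_mul_of_nonneg_right h9 h7.le
    have h12 : C * ‖(u : H)‖ ^ 2 < D * ‖(u : H)‖ ^ 2 :=
      mul_lt_mul_of_pos_right (by have := le_abs_self C; linarith) h7
    have h13 : 0 ≤ (t - b) * ‖(u : H)‖ ^ 2 := mul_nonneg (by linarith) h7.le
    linarith

end

end RationalPencil

/-! ### Assembling the eigenvalue sequences and the theorem -/

namespace RationalPencil

variable {H : Type*} [NormedAddCommGroup H] [InnerProductSpace ℂ H] [CompleteSpace H]
  {A : H →ₗ.[ℂ] H} {L : ℕ} {Γ : ℕ → H →L[ℂ] H} {c : ℕ → ℝ}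

/-- The eigenvalues in one interval between poles are enumerated by a sequence. -/
theorem exists_eigenvalue_enumeration (hA : IsSemiboundedDiscrete A)
    (hΓ : ∀ l ∈ Finset.Icc 1 L, (Γ l).IsPositive) (hc : StrictMonoOn c (Set.Icc 1 L)) {l : ℕ}
    (hl : l ∈ Finset.Icc 1 (L + 1)) :
    ∃ (n : ℕ∞) (lam : ℕ → ℝ), EnumeratesEigenvalues A L Γ c l n lam ∧
      (∀ t ∈ interval L c l, ∀ j : ℕ, 1 ≤ j → (j : ℕ∞) ≤ n →
        (lam j ≤ t ↔ j + indexShift A L Γ c l ≤ nonposCount A L Γ c t)) ∧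
      (n = ⊤ ↔ ∀ k : ℕ, ∃ t ∈ interval L c l, k ≤ negCount A L Γ c t) := by
  obtain ⟨α, hα, hκ⟩ := exists_negCount_eq_indexShift (A := A) (Γ := Γ) hc hl
  obtain ⟨n, lam, h1, h2, h3, h4, h5⟩ := exists_jump_enumeration (ordConnected_interval l)
    (negCount A L Γ c) (nonposCount A L Γ c) (κ := indexShift A L Γ c l) hα
    (fun s hs t ht hst => nonposCount_le_negCount hA hΓ hc hl hs ht hst)
    (fun t _ => by rw [nonposCount_eq hA hΓ]; exact Nat.le_add_right _ _)
    (fun t ht => exists_lt_negCount_le hA hΓ hc hl ht)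
    (fun t ht => exists_gt_nonposCount_le hA hΓ hc hl ht)
    (fun t ht hlt => nonposCount_le_indexShift hA hΓ hc hl hα hκ ht hlt)
    (fun t ht => indexShift_le ht)
  exact ⟨n, lam, ⟨h1, h2, fun t ht => (h3 t ht).trans (dimE_eigenspace hA hΓ t).symm⟩, h4, h5⟩

omit [CompleteSpace H] in
/-- If an interval contains infinitely many eigenvalues, they eventually exceed every point. -/
theorem eventually_lt_eigenvalue {l : ℕ} {n : ℕ∞} {lam : ℕ → ℝ} (hn : n = ⊤)
    (h : ∀ t ∈ interval L c l, ∀ j : ℕ, 1 ≤ j → (j : ℕ∞) ≤ n →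
        (lam j ≤ t ↔ j + indexShift A L Γ c l ≤ nonposCount A L Γ c t)) {t : ℝ}
    (ht : t ∈ interval L c l) : ∀ᶠ j in Filter.atTop, t < lam j := by
  filter_upwards [Filter.eventually_ge_atTop (nonposCount A L Γ c t + 1)] with j hj
  by_contra! hle
  have := (h t ht j (by omega) (by rw [hn]; exact le_top)).1 hle
  omega

/-- Close to the left end of an interval there are no eigenvalues and the number of negative
eigenvalues is the index shift. -/
theorem exists_gap_right_of_pole (hA : IsSemiboundedDiscrete A)
    (hΓ : ∀ l ∈ Finset.Icc 1 L, (Γ l).IsPositive) (hc : StrictMonoOn c (Set.Icc 1 L)) {l : ℕ}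
    (hl : l ∈ Finset.Icc 1 (L + 1)) : ∃ α ∈ interval L c l, ∀ t ∈ interval L c l, t < α →
      ((t : ℝ) : ℂ) ∈ pencilResolventSet A L Γ c ∧
      dimE (spectralSubspace (schur A L Γ c (t : ℂ)) (Set.Iio 0)) =
        (indexShift A L Γ c l : ℕ∞) := by
  obtain ⟨α, hα, hκ⟩ := exists_negCount_eq_indexShift (A := A) (Γ := Γ) hc hl
  refine ⟨α, hα, fun t ht hlt => ?_⟩
  -- The chain `κ ≤ negCount ≤ nonposCount ≤ κ` collapses, so the kernel is trivial and the count
  -- equals `κ`.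
  have h1 := nonposCount_le_indexShift hA hΓ hc hl hα hκ ht hlt
  have h2 : indexShift A L Γ c l ≤ negCount A L Γ c t := indexShift_le ht
  have h3 := nonposCount_eq hA hΓ (c := c) t
  have hT := isSemiboundedDiscrete_schur hA hΓ (c := c) t
  refine ⟨⟨offPoles_of_mem_interval hc hl ht, ?_⟩, ?_⟩
  · rw [zero_mem_resolventSet_schur_iff hA]
    have := hT.finiteDimensional_eigenspace 0
    rw [Complex.ofReal_zero] at this
    exact Submodule.finrank_eq_zero.1 (by omega)
  · rw [hT.dimE_Iio, Nat.cast_inj]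
    change negCount A L Γ c t = _
    omega

/-- The spectrum is exhausted by the sequences of eigenvalues. -/
theorem pencilSpectrum_eq_iUnion (hA : IsSemiboundedDiscrete A)
    (hΓ : ∀ l ∈ Finset.Icc 1 L, (Γ l).IsPositive) (hc : StrictMonoOn c (Set.Icc 1 L))
    {n : ℕ → ℕ∞} {lam : ℕ → ℕ → ℝ}
    (h : ∀ l ∈ Finset.Icc 1 (L + 1), EnumeratesEigenvalues A L Γ c l (n l) (lam l)) :
    pencilSpectrum A L Γ c = {z : ℂ | ∃ l ∈ Finset.Icc 1 (L + 1), ∃ j : ℕ, 1 ≤ j ∧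
      (j : ℕ∞) ≤ n l ∧ z = ((lam l j : ℝ) : ℂ)} := by
  have hzero : ∀ t : ℝ, dimE (eigenspace (schur A L Γ c (t : ℂ)) 0) = 0 ↔
      eigenspace (schur A L Γ c (t : ℂ)) 0 = ⊥ := fun t => by
    rw [dimE, Cardinal.toENat_eq_zero, Submodule.rank_eq_zero]
  rw [pencilSpectrum_eq hA]
  ext z
  constructor
  · intro hz
    have him := im_eq_zero_of_mem_pencilPointSpectrum hA hΓ hz
    obtain ⟨t, rfl⟩ : ∃ t : ℝ, z = t := ⟨z.re, Complex.ext rfl (by simpa using him)⟩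
    obtain ⟨l, hl, ht⟩ := exists_mem_interval hz.1
    have hne := mt (hzero t).1 hz.2
    rw [← (h l hl).2.2 t ht, Set.encard_eq_zero, ← ne_eq, ← Set.nonempty_iff_ne_empty] at hne
    obtain ⟨j, hj, hjn, rfl⟩ := hne
    exact ⟨l, hl, j, hj, hjn, rfl⟩
  · rintro ⟨l, hl, j, hj, hjn, rfl⟩
    have ht := (h l hl).1 j hj hjn
    refine ⟨offPoles_of_mem_interval hc hl ht, fun h0 => ?_⟩
    have := (h l hl).2.2 _ ht
    rw [(hzero _).2 h0, Set.encard_eq_zero] at this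
    exact Set.notMem_empty j (this ▸ ⟨hj, hjn, rfl⟩)

end RationalPencil

end

open RationalPencil

theorem theorem4p5 {H : Type*} [NormedAddCommGroup H] [InnerProductSpace ℂ H] [CompleteSpace H]
    (A : H →ₗ.[ℂ] H) (hA : IsSelfAdjoint A) (hbelow : RationalPencil.IsBoundedBelow A)
    (hcomp : RationalPencil.HasCompactResolvent A)
    (L : ℕ) (hL : 1 ≤ L)
    (Γ : ℕ → H →L[ℂ] H) (hΓ : ∀ l ∈ Finset.Icc 1 L, (Γ l).IsPositive ∧ Γ l ≠ 0)
    (c : ℕ → ℝ) (hc : StrictMonoOn c (Set.Icc 1 L)) :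
    -- strict monotonicity of `t ↦ (S(t)u, u)` between the poles
    (∀ l ∈ Finset.Icc 1 (L + 1), ∀ u : A.domain, u ≠ 0 →
      StrictAntiOn (RationalPencil.schurForm A L Γ c u) (RationalPencil.interval L c l) ∧
      {t | t ∈ RationalPencil.interval L c l ∧
        RationalPencil.schurForm A L Γ c u t = 0}.Subsingleton ∧
      -- the three cases in the definition of `p_l(u)` are exhaustive
      ((∃ t ∈ RationalPencil.interval L c l, RationalPencil.schurForm A L Γ c u t = 0 ∧
          RationalPencil.rayleigh A L Γ c l u = (t : EReal)) ∨
        ((∀ t ∈ RationalPencil.interval L c l, RationalPencil.schurForm A L Γ c u t < 0) ∧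
          RationalPencil.rayleigh A L Γ c l u = RationalPencil.cExt L c (l - 1)) ∨
        ((∀ t ∈ RationalPencil.interval L c l, 0 < RationalPencil.schurForm A L Γ c u t) ∧
          RationalPencil.rayleigh A L Γ c l u = RationalPencil.cExt L c l))) ∧
    ∃ (κ : ℕ → ℕ) (n : ℕ → ℕ∞) (lam : ℕ → ℕ → ℝ),
      -- the spectrum consists of `L + 1` sequences of eigenvalues
      (∀ l ∈ Finset.Icc 1 (L + 1),
        RationalPencil.EnumeratesEigenvalues A L Γ c l (n l) (lam l)) ∧
      RationalPencil.pencilSpectrum A L Γ c = RationalPencil.pencilPointSpectrum A L Γ c ∧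
      RationalPencil.pencilSpectrum A L Γ c =
        {z : ℂ | ∃ l ∈ Finset.Icc 1 (L + 1), ∃ j : ℕ, 1 ≤ j ∧ (j : ℕ∞) ≤ n l ∧
          z = ((lam l j : ℝ) : ℂ)} ∧
      -- the index shifts: gaps to the right of `c_{l-1}` and constant number of negative eigenvalues
      (∀ l ∈ Finset.Icc 1 (L + 1), ∃ α ∈ RationalPencil.interval L c l,
        ∀ t ∈ RationalPencil.interval L c l, t < α →
          ((t : ℝ) : ℂ) ∈ RationalPencil.pencilResolventSet A L Γ c ∧
          RationalPencil.dimE (RationalPencil.spectralSubspace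
            (RationalPencil.schur A L Γ c (t : ℂ)) (Set.Iio 0)) = (κ l : ℕ∞)) ∧
      -- the min-max principle
      (∀ l ∈ Finset.Icc 1 (L + 1), ∀ j : ℕ, 1 ≤ j → (j : ℕ∞) ≤ n l →
        (∀ V : Submodule ℂ A.domain, Module.finrank ℂ V = j + κ l →
          ∃ m : EReal, RationalPencil.IsRayleighMax A L Γ c l V m) ∧
        IsLeast {m : EReal | ∃ V : Submodule ℂ A.domain, Module.finrank ℂ V = j + κ l ∧
          RationalPencil.IsRayleighMax A L Γ c l V m} ((lam l j : ℝ) : EReal)) ∧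
      -- estimates for the index shifts
      κ 1 = 0 ∧
      (∀ l ∈ Finset.Icc 2 (L + 1), (κ l : ℕ∞) ≤
        RationalPencil.eigCount (RationalPencil.shiftOp A L Γ c l) (c (l - 1))) ∧
      (κ (L + 1) : ℕ∞) ≤ RationalPencil.eigCount A (c L) ∧
      (∀ l ∈ Finset.Icc 2 (L + 1), IsClosed (Set.range (Γ (l - 1))) →
        ∀ t ∈ RationalPencil.interval L c l, (κ l : ℕ∞) ≤
          RationalPencil.dimE
            (LinearMap.range (RationalPencil.compressedOp A L Γ c l t).toFun)) ∧
      (IsClosed (Set.range (Γ L)) →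
        (κ (L + 1) : ℕ∞) ≤ RationalPencil.dimE (LinearMap.range
          ((RationalPencil.projP A c L ∘L RationalPencil.projQ Γ L : H →L[ℂ] H) : H →ₗ[ℂ] H)) ∧
        RationalPencil.dimE (LinearMap.range
          ((RationalPencil.projP A c L ∘L RationalPencil.projQ Γ L : H →L[ℂ] H) : H →ₗ[ℂ] H)) ≤
          min (RationalPencil.eigCount A (c L))
            (RationalPencil.dimE (LinearMap.ker (Γ L : H →ₗ[ℂ] H)))) ∧
      -- infinitely many eigenvalues above the last pole
      (n (L + 1) = ⊤ ↔ ¬ FiniteDimensional ℂ H) ∧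
      (n (L + 1) = ⊤ → Filter.Tendsto (lam (L + 1)) Filter.atTop Filter.atTop) ∧
      -- infinitely many eigenvalues to the left of the pole `c_l`
      (∀ l ∈ Finset.Icc 1 L,
        (n l = ⊤ ↔
          ¬ FiniteDimensional ℂ (LinearMap.range (Γ l : H →ₗ[ℂ] H)).topologicalClosure) ∧
        (n l = ⊤ → Filter.Tendsto (lam l) Filter.atTop (nhdsWithin (c l) (Set.Iio (c l))))) := by
  have hA' : IsSemiboundedDiscrete A := .of_isSelfAdjoint hA hbelow hcomp
  have hdense : Dense (A.domain : Set H) := hA.dense_domain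
  have hpos : ∀ l ∈ Finset.Icc 1 L, (Γ l).IsPositive := fun l hl => (hΓ l hl).1
  have hlast : L + 1 ∈ Finset.Icc 1 (L + 1) := Finset.mem_Icc.2 ⟨by omega, le_rfl⟩
  have hlast2 : L + 1 ∈ Finset.Icc 2 (L + 1) := Finset.mem_Icc.2 ⟨by omega, le_rfl⟩
  refine ⟨fun l hl u hu => ⟨schurForm_strictAntiOn hpos hc hl hu, fun s hs t ht =>
    (schurForm_strictAntiOn hpos hc hl hu).injOn hs.1 ht.1 (hs.2.trans ht.2.symm),
    rayleigh_trichotomy hc hl u⟩, ?_⟩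
  have henum : ∀ l, ∃ (n : ℕ∞) (lam : ℕ → ℝ), l ∈ Finset.Icc 1 (L + 1) →
      EnumeratesEigenvalues A L Γ c l n lam ∧
      (∀ t ∈ interval L c l, ∀ j : ℕ, 1 ≤ j → (j : ℕ∞) ≤ n →
        (lam j ≤ t ↔ j + indexShift A L Γ c l ≤ nonposCount A L Γ c t)) ∧
      (n = ⊤ ↔ ∀ k : ℕ, ∃ t ∈ interval L c l, k ≤ negCount A L Γ c t) := by
    intro l
    by_cases hl : l ∈ Finset.Icc 1 (L + 1)
    · obtain ⟨n, lam, h⟩ := exists_eigenvalue_enumeration hA' hpos hc hl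
      exact ⟨n, lam, fun _ => h⟩
    · exact ⟨0, 0, fun h => absurd h hl⟩
  choose n lam hnl using henum
  have hE := fun l hl => (hnl l hl).1
  refine ⟨indexShift A L Γ c, n, lam, hE, pencilSpectrum_eq hA',
    pencilSpectrum_eq_iUnion hA' hpos hc hE,
    fun l hl => exists_gap_right_of_pole hA' hpos hc hl, fun l hl j hj hjn => ?_,
    indexShift_one_eq_zero hA' hpos hL hc,
    fun l hl => indexShift_le_numLE_shiftOp hA' hpos hc hl, ?_,
    fun l hl hcl t ht => indexShift_le_rank_compressedOp hA' hpos hc hl hcl ht,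
    fun hcl => ⟨indexShift_last_le_rank hA' hpos hc hL hcl, dimE_range_comp_le⟩, ?_, ?_, ?_⟩
  · exact min_max_principle hpos hc hl hA' (by omega) ((hE l hl).1 j hj hjn)
      fun t ht => (hnl l hl).2.1 t ht j hj hjn
  · have h := indexShift_le_numLE_shiftOp hA' hpos hc hlast2
    -- For `l = L + 1` the sum over the remaining poles is empty.
    have hshift : shiftOp A L Γ c (L + 1) = A := by
      rw [shiftOp, Finset.Icc_eq_empty (by omega), Finset.sum_empty, neg_zero,
        ContinuousLinearMap.toLinearMap_zero, zero_vadd]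
    rwa [hshift] at h
  · rw [(hnl _ hlast).2.2]
    exact negCount_unbounded_last_iff hA' hpos hc hdense
  · intro htop
    refine Filter.tendsto_atTop.2 fun M => ?_
    have hM : max M (c L + 1) ∈ interval L c (L + 1) := by
      refine ⟨?_, by simp [cExt]⟩
      rw [cExt, if_neg (by omega), if_pos (by omega), EReal.coe_lt_coe_iff]
      exact (lt_add_one _).trans_le (le_max_right _ _)
    filter_upwards [eventually_lt_eigenvalue htop (hnl _ hlast).2.1 hM] with j hj
    exact (le_max_left _ _).trans hj.le
  · intro l hlL
    have hlm := Finset.mem_Icc.1 hlL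
    have hl : l ∈ Finset.Icc 1 (L + 1) := Finset.mem_Icc.2 ⟨hlm.1, by omega⟩
    have hcl : cExt L c l = (c l : EReal) := by rw [cExt, if_neg (by omega), if_pos hlm.2]
    refine ⟨?_, fun htop => ?_⟩
    · rw [(hnl l hl).2.2, finiteDimensional_topologicalClosure_iff]
      exact negCount_unbounded_iff hA' hpos hc hdense hlL
    · have hlt : ∀ᶠ j in Filter.atTop, lam l j < c l := by
        filter_upwards [Filter.eventually_ge_atTop 1] with j hj
        exact gt_of_mem_interval hc hl ((hE l hl).1 j hj (by rw [htop]; exact le_top)) hlL le_rfl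
      refine tendsto_nhdsWithin_iff.2 ⟨tendsto_order.2 ⟨fun a ha => ?_, fun a ha => ?_⟩, hlt⟩
      -- The point `a` may lie to the left of the interval, hence the maximum with its left
      -- endpoint.
      · obtain ⟨t, ht, h1, -⟩ := exists_mem_interval_btwn (L := L) (c := c) (l := l)
          (a := max (cExt L c (l - 1)) a) (le_max_left _ _) le_rfl
          (max_lt (cExt_lt hc hl) (by rw [hcl]; exact EReal.coe_lt_coe_iff.2 ha))
        filter_upwards [eventually_lt_eigenvalue htop (hnl l hl).2.1 ht] with j hj
        exact (EReal.coe_lt_coe_iff.1 ((le_max_right _ _).trans_lt h1)).trans hj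
      · filter_upwards [hlt] with j hj
        exact hj.trans ha
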